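/- All digraphs are finite, without loops and without parallel arcs; two opposite arcs $uv$, $vu$ are allowed. Write $d_D^+(v)$, $d_D^-(v)$ for the out- and in-degree of a vertex $v$ of a digraph $D$, and $\Delta^+(D)$, $\Delta^-(D)$ for the maximum out-degree and the maximum in-degree of $D$. The digraph $D$ is connected if its underlying undirected graph is connected (in particular $D$ has at least one vertex). A cover of $D$ is a pair $(X,H)$ where $H$ is a digraph and $X$ assigns to each $v\in V(D)$ a set $X_v\subseteq V(H)$ such that: the sets $X_v$ are pairwise disjoint and $V(H)=\bigcup_{v\in V(D)}X_v$; each $X_v$ is an independent set of $H$; for each arc $uv\in A(D)$ the arcs of $H$ from $X_u$ to $X_v$ form a (possibly empty) matching, that is, no two of them have a common end-vertex; and every arc of $H$ goes from $X_u$ to $X_v$ for some arc $uv\in A(D)$. The digraph $D$ is $(X,H)$-colorable if there is a set $T\subseteq V(H)$ with $|T\cap X_v|=1$ for all $v\in V(D)$ such that $H[T]$ contains no directed cycle (directed cycles have length at least $2$; a pair of opposite arcs is a directed cycle of length $2$). For an integer $k\ge 0$, $D$ is DP-$k$-colorable if $D$ is $(X,H)$-colorable for every cover $(X,H)$ of $D$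 with $|X_v|\ge k$ for all $v\in V(D)$. The DP-chromatic number $\chi_{\mathrm{DP}}(D)$ is the smallest integer $k\ge 0$ such that $D$ is DP-$k$-colorable. A bidirected graph is a digraph obtained from a simple undirected graph by replacing each edge by two opposite arcs; it is a bidirected cycle of length $p\ge 3$, respectively a bidirected complete graph, if the undirected graph is a cycle of length $p$, respectively a complete graph on $n\ge 1$ vertices. **Theorem.** Let $D$ be a connected digraph. Then $$\chi_{\mathrm{DP}}(D)\le \max\{\Delta^+(D),\Delta^-(D)\}+1,$$ and equality holds if and only if $D$ is (a) a directed cycle of length $\ge 2$, or (b) a bidirected cycle of length $\ge 3$, or (c) a bidirected complete graph. -/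

import Mathlib

universe u

namespace Digraph

variable {V : Type u}

/-- Out-degree: the number of out-neighbours of `v`. -/
noncomputable def outDeg (D : Digraph V) (v : V) : ℕ := {w | D.Adj v w}.ncard

/-- In-degree: the number of in-neighbours of `v`. -/
noncomputable def inDeg (D : Digraph V) (v : V) : ℕ := {w | D.Adj w v}.ncard

/-- Maximum out-degree of a finite digraph. -/
noncomputable def maxOutDeg [Fintype V] (D : Digraph V) : ℕ := Finset.univ.sup D.outDeg

/-- Maximum in-degree of a finite digraph. -/
noncomputable def maxInDeg [Fintype V] (D : Digraph V) : ℕ := Finset.univ.sup D.inDeg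

/-- The subdigraph induced by the vertex set `T` contains a directed cycle (of some length `p ≥ 2`,
with pairwise distinct vertices `c 0, …, c (p - 1)`, indices modulo `p`). -/
def HasDirectedCycleIn (D : Digraph V) (T : Set V) : Prop :=
  ∃ p : ℕ, 2 ≤ p ∧ ∃ c : ZMod p → V,
    Function.Injective c ∧ (∀ i, c i ∈ T) ∧ ∀ i, D.Adj (c i) (c (i + 1))

/-- A set of arcs, given as (initial vertex, terminal vertex), is a matching if no two distinct
arcs in it have a common end-vertex. -/
def IsArcMatching (M : Set (V × V)) : Prop :=
  ∀ a ∈ M, ∀ b ∈ M, a ≠ b → Disjoint ({a.1, a.2} : Set V) {b.1, b.2}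

/-- `D` is a directed cycle of length `≥ 2`: its vertices can be enumerated without repetition as
`e 0, …, e (p - 1)` so that its arcs are exactly `e i → e (i + 1)`, indices modulo `p`. -/
def IsDirectedCycle (D : Digraph V) : Prop :=
  ∃ p : ℕ, 2 ≤ p ∧ ∃ e : ZMod p ≃ V, ∀ i j, D.Adj (e i) (e j) ↔ j = i + 1

/-- The bidirected graph obtained from a simple graph by replacing each edge by two opposite
arcs. -/
def bidirected (G : SimpleGraph V) : Digraph V := ⟨G.Adj⟩

/-- `D` is a bidirected cycle of length `≥ 3`. -/
def IsBidirectedCycle (D : Digraph V) : Prop :=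
  ∃ G : SimpleGraph V, D = bidirected G ∧
    ∃ p : ℕ, 3 ≤ p ∧ Nonempty (G ≃g SimpleGraph.cycleGraph p)

/-- `D` is a bidirected complete graph (of any order, including order one). -/
def IsBidirectedComplete (D : Digraph V) : Prop :=
  D = bidirected (⊤ : SimpleGraph V)

/-- A cover `(X, H)` of the digraph `D`, the vertices of `H` (the colors) being the elements
of `W`. -/
structure DPCover (D : Digraph V) (W : Type u) where
  /-- the color set of each vertex -/
  X : V → Set W
  /-- the digraph on the colors -/
  H : Digraph W
  disjoint : ∀ u v, u ≠ v → Disjoint (X u) (X v)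
  iUnion_eq : ⋃ v, X v = Set.univ
  indep : ∀ v, ∀ x ∈ X v, ∀ y ∈ X v, ¬ H.Adj x y
  matching : ∀ u v, D.Adj u v →
    IsArcMatching {a : W × W | a.1 ∈ X u ∧ a.2 ∈ X v ∧ H.Adj a.1 a.2}
  /-- every arc of `H` belongs to the matching of some arc of `D` -/
  arcs : ∀ x y, H.Adj x y → ∃ u v, D.Adj u v ∧ x ∈ X u ∧ y ∈ X v

/-- `T` meets each color set in exactly one color. -/
def DPCover.IsTransversal {D : Digraph V} {W : Type u} (C : D.DPCover W) (T : Set W) : Prop :=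
  ∀ v, ∃! x, x ∈ T ∧ x ∈ C.X v

/-- `D` is `(X, H)`-colorable: the cover has an acyclic transversal. -/
def DPCover.Colorable {D : Digraph V} {W : Type u} (C : D.DPCover W) : Prop :=
  ∃ T : Set W, C.IsTransversal T ∧ ¬ C.H.HasDirectedCycleIn T

/-- `D` is DP-`f`-colorable: `D` is `(X, H)`-colorable for every (finite) cover `(X, H)` with
`|X v| ≥ f v` for all `v`. -/
def DPColorableFun (D : Digraph V) (f : V → ℕ) : Prop :=
  ∀ (W : Type u) [Finite W] (C : D.DPCover W), (∀ v, f v ≤ (C.X v).ncard) → C.Colorable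

/-- `D` is DP-`k`-colorable. -/
def DPColorable (D : Digraph V) (k : ℕ) : Prop := D.DPColorableFun fun _ => k

/-- The DP-chromatic number: the least `k` such that `D` is DP-`k`-colorable (it would be `⊤` if
there were no such `k`). -/
noncomputable def dpChromaticNumber (D : Digraph V) : ℕ∞ :=
  ⨅ k ∈ {k : ℕ | D.DPColorable k}, (k : ℕ∞)

end Digraph

/-! Upper bound: colour the vertices one at a time. A vertex with more colours than out-neighbours
has a colour without arcs to the colours already chosen, and such a colour closes no directed cycle.

For equality, let k be the maximum degree and suppose that a cover with at least k colours per
vertex has no acyclic transversal. Greedy colouring towards a vertex v leaves only v open: a hole.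
Every colour of v must then send an arc to a chosen colour, and the matchings make these targets
distinct, so v has exactly k colours, k out-neighbours and k in-neighbours (`out_aux`). Whatever
colour v gets, it has one chosen out-neighbour and one chosen in-neighbour, and the hole can be
pushed around an induced directed cycle (`succ`, `F_of_adj`).

If k = 1, this cycle is all of D. Let k ≥ 2. By `not_adj_orbit`, v separates a cycle of length at
least three from the part attached at v off the cycle. An arc without opposite lies on such a cycle;
choosing the attached part minimal makes it bidirected, and `exists_hamiltonian` then puts all
vertices of D inside it, which is absurd since it misses the cycle. So D is bidirected and
Hamiltonian. For k = 2 it is a cycle. For k ≥ 3 two nonadjacent vertices yield an induced path on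
three vertices, excluded by `no_fork`.

Conversely, each exceptional digraph has an explicit cover in which every transversal contains a
directed cycle. -/

namespace Digraph

open Relation Set

variable {V W : Type u}

/-! ### Acyclic vertex sets. -/

/-- The relation `R` restricted to `S` has no closed walk. -/
def AcyclicOn (R : V → V → Prop) (S : Set V) : Prop :=
  ∀ v, ¬ TransGen (fun a b => a ∈ S ∧ b ∈ S ∧ R a b) v v

theorem AcyclicOn.mono {R R' : V → V → Prop} {S S' : Set V} (h : AcyclicOn R' S') (hS : S ⊆ S')
    (hR : ∀ a ∈ S, ∀ b ∈ S, R a b → R' a b) : AcyclicOn R S := fun v hv =>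
  h v (TransGen.mono (fun _ _ hab => ⟨hS hab.1, hS hab.2.1, hR _ hab.1 _ hab.2.1 hab.2.2⟩) _ _ hv)

theorem AcyclicOn.swap {R : V → V → Prop} {S : Set V} (h : AcyclicOn R S) :
    AcyclicOn (fun a b => R b a) S := fun v hv => by
  refine h v ?_
  rw [← transGen_swap]
  exact TransGen.mono (fun a b hab => ⟨hab.2.1, hab.1, hab.2.2⟩) _ _ hv

theorem acyclicOn_empty (R : V → V → Prop) : AcyclicOn R ∅ := fun v hv => by
  obtain ⟨_, h, _⟩ := TransGen.head'_iff.1 hv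
  exact h.1.elim

/-- A vertex without successors lies on no closed walk. -/
theorem AcyclicOn.insert_of_no_out {R : V → V → Prop} {S : Set V} {v : V} (h : AcyclicOn R S)
    (hv : ∀ w ∈ insert v S, ¬ R v w) : AcyclicOn R (insert v S) := by
  intro a ha
  -- Having no successor, `v` can only be the last vertex of a walk.
  have key : ∀ b, TransGen (fun a b => a ∈ insert v S ∧ b ∈ insert v S ∧ R a b) a b →
      b = v ∨ TransGen (fun a b => a ∈ S ∧ b ∈ S ∧ R a b) a b := by
    have aux : ∀ x y, x ∈ insert v S → y ∈ insert v S → R x y → x ∈ S := by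
      rintro x y (rfl | hx) hy hxy
      · exact (hv y hy hxy).elim
      · exact hx
    intro b hb
    induction hb with
    | single h1 =>
      obtain ⟨h1, h2, h3⟩ := h1
      have := aux _ _ h1 h2 h3
      rcases h2 with rfl | h2
      · exact .inl rfl
      · exact .inr (.single ⟨this, h2, h3⟩)
    | tail _ h1 ih =>
      obtain ⟨h1, h2, h3⟩ := h1
      have := aux _ _ h1 h2 h3
      rcases ih with rfl | ih
      · exact (hv _ h2 h3).elim
      rcases h2 with rfl | h2
      · exact .inl rfl
      · exact .inr (ih.tail ⟨this, h2, h3⟩)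
  rcases key a ha with rfl | h1
  · obtain ⟨c, ⟨_, h2, h3⟩, _⟩ := TransGen.head'_iff.1 ha
    exact hv c h2 h3
  · exact h a h1

/-- The assignment `φ` with the value at `v` replaced by `x`. -/
noncomputable def recolor (φ : V → W) (v : V) (x : W) : V → W :=
  open Classical in Function.update φ v x

@[simp] theorem recolor_self (φ : V → W) (v : V) (x : W) : recolor φ v x v = x := by
  simp [recolor]

theorem recolor_of_ne {φ : V → W} {v u : V} {x : W} (h : u ≠ v) : recolor φ v x u = φ u := by
  simp [recolor, h]

/-! ### Covers and greedy colouring. -/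

/-- A cover of the digraph with arc relation `A`, given by color sets and arcs between colors. -/
structure ArcCover (A : V → V → Prop) (W : Type u) where
  /-- the colors of a vertex -/
  X : V → Set W
  /-- the arcs between colors -/
  H : W → W → Prop
  irrefl : ∀ v, ¬ A v v
  proj : ∀ {u v x y}, x ∈ X u → y ∈ X v → H x y → A u v
  out_unique : ∀ {u v x y y'}, x ∈ X u → y ∈ X v → y' ∈ X v → H x y → H x y' → y = y'
  in_unique : ∀ {u v x x' y}, x ∈ X u → x' ∈ X u → y ∈ X v → H x y → H x' y → x = x'

namespace ArcCover

variable {A : V → V → Prop} (C : ArcCover A W)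

/-- The cover with all arcs reversed. -/
def reverse : ArcCover (fun a b => A b a) W where
  X := C.X
  H := fun x y => C.H y x
  irrefl := C.irrefl
  proj := fun hx hy h => C.proj hy hx h
  out_unique := fun hx hy hy' h h' => C.in_unique hy hy' hx h h'
  in_unique := fun hx hx' hy h h' => C.out_unique hy hx hx' h h'

/-- The arcs between the colors chosen by `φ`, as a relation on vertices. -/
def F (φ : V → W) (a b : V) : Prop := C.H (φ a) (φ b)

/-- `φ` chooses for each vertex one of its colors. -/
def IsChoice (φ : V → W) : Prop := ∀ v, φ v ∈ C.X v

variable {C} {φ ψ : V → W} {u v w : V} {S : Set V}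

theorem IsChoice.recolor {x : W} (h : C.IsChoice φ) (hx : x ∈ C.X v) :
    C.IsChoice (recolor φ v x) := fun u => by
  by_cases huv : u = v
  · subst huv; simpa using hx
  · rw [recolor_of_ne huv]; exact h u

theorem IsChoice.adj (h : C.IsChoice φ) (huv : C.F φ u v) : A u v := C.proj (h u) (h v) huv

theorem IsChoice.ne (h : C.IsChoice φ) (huv : C.F φ u v) : u ≠ v := by
  rintro rfl
  exact C.irrefl _ (h.adj huv)

theorem F_recolor {x : W} (hu : u ≠ v) (hw : w ≠ v) :
    C.F (Digraph.recolor φ v x) u w ↔ C.F φ u w := by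
  simp [F, recolor_of_ne hu, recolor_of_ne hw]

theorem F_recolor_left {x : W} (hw : w ≠ v) :
    C.F (Digraph.recolor φ v x) v w ↔ C.H x (φ w) := by
  simp [F, recolor_of_ne hw]

theorem F_recolor_right {x : W} (hw : w ≠ v) :
    C.F (Digraph.recolor φ v x) w v ↔ C.H (φ w) x := by
  simp [F, recolor_of_ne hw]

/-- If some color of `v` has no out-neighbour among the colors chosen on `S`, then `φ` can be
extended to `v`. -/
theorem exists_recolor_of_no_out {x : W} (hφ : C.IsChoice φ) (hS : AcyclicOn (C.F φ) S)
    (hv : v ∉ S) (hx : x ∈ C.X v) (h : ∀ w ∈ S, ¬ C.H x (φ w)) :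
    AcyclicOn (C.F (recolor φ v x)) (insert v S) := by
  have hne : ∀ a ∈ S, a ≠ v := fun a ha h => hv (h ▸ ha)
  refine AcyclicOn.insert_of_no_out (hS.mono subset_rfl fun a ha b hb h =>
    (F_recolor (hne a ha) (hne b hb)).1 h) ?_
  rintro w (rfl | hw) hvw
  · exact (hφ.recolor hx).ne hvw rfl
  · exact h w hw ((F_recolor_left (hne w hw)).1 hvw)

/-- The arcs over a fixed arc of the digraph form a matching, so two colours of `v` cannot point at
the same chosen colour. This injection drives every counting argument below. -/
theorem exists_out_choice [Finite V] (hφ : C.IsChoice φ)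
    (h : ∀ x ∈ C.X v, ∃ w ∈ S, C.H x (φ w)) :
    ∃ f : W → V, (∀ x ∈ C.X v, f x ∈ S ∧ A v (f x) ∧ C.H x (φ (f x))) ∧ InjOn f (C.X v) := by
  have : Nonempty V := ⟨v⟩
  choose! f hf using h
  refine ⟨f, fun x hx => ⟨(hf x hx).1, C.proj hx (hφ _) (hf x hx).2, (hf x hx).2⟩, ?_⟩
  intro x hx y hy hxy
  refine C.in_unique hx hy (hφ (f x)) (hf x hx).2 ?_
  rw [hxy]
  exact (hf y hy).2

theorem exists_recolor_of_out_lt [Finite V] (hφ : C.IsChoice φ) (hS : AcyclicOn (C.F φ) S)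
    (hv : v ∉ S) (h : {w | A v w ∧ w ∈ S}.ncard < (C.X v).ncard) :
    ∃ x ∈ C.X v, AcyclicOn (C.F (Digraph.recolor φ v x)) (insert v S) := by
  by_contra! hcon
  have h1 : ∀ x ∈ C.X v, ∃ w ∈ S, C.H x (φ w) := fun x hx => by
    by_contra! h1
    exact hcon x hx (exists_recolor_of_no_out hφ hS hv hx h1)
  obtain ⟨f, hf, hinj⟩ := exists_out_choice hφ h1
  exact h.not_ge (ncard_le_ncard_of_injOn f (fun x hx => ⟨(hf x hx).2.1, (hf x hx).1⟩) hinj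
    (toFinite _))

theorem exists_recolor_of_in_lt [Finite V] (hφ : C.IsChoice φ) (hS : AcyclicOn (C.F φ) S)
    (hv : v ∉ S) (h : {w | A w v ∧ w ∈ S}.ncard < (C.X v).ncard) :
    ∃ x ∈ C.X v, AcyclicOn (C.F (Digraph.recolor φ v x)) (insert v S) := by
  obtain ⟨x, hx, h1⟩ := exists_recolor_of_out_lt (C := C.reverse) hφ hS.swap hv h
  exact ⟨x, hx, h1.swap⟩

/-- A digraph whose out-degrees are smaller than the number of colors has an acyclic choice. -/
theorem exists_acyclic_of_outDeg_lt [Finite V] (h : ∀ v, {w | A v w}.ncard < (C.X v).ncard) :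
    ∃ φ, C.IsChoice φ ∧ AcyclicOn (C.F φ) univ := by
  have h0 : ∀ v, (C.X v).Nonempty := fun v => by
    by_contra h1
    rw [not_nonempty_iff_eq_empty] at h1
    have := h v
    simp [h1] at this
  choose φ0 hφ0 using h0
  have key : ∀ S : Set V, ∃ φ, C.IsChoice φ ∧ AcyclicOn (C.F φ) S := by
    intro S
    induction S, toFinite S using Set.Finite.induction_on with
    | empty => exact ⟨φ0, hφ0, acyclicOn_empty _⟩
    | @insert a S ha _ ih =>
      obtain ⟨φ, hφ, hS⟩ := ih
      obtain ⟨x, hx, h2⟩ := exists_recolor_of_out_lt hφ hS ha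
        ((ncard_le_ncard (fun w hw => hw.1) (toFinite _)).trans_lt (h a))
      exact ⟨_, hφ.recolor hx, h2⟩
  exact key univ

/-! ### Critical covers and holes. -/

variable (C) in
/-- `C` has at least `k` colors at each vertex of a connected digraph with degrees at most `k`, but
no acyclic choice. -/
structure IsCritical (k : ℕ) : Prop where
  out_le : ∀ v, {w | A v w}.ncard ≤ k
  in_le : ∀ v, {w | A w v}.ncard ≤ k
  le_card : ∀ v, k ≤ (C.X v).ncard
  not_acyclic : ∀ φ, C.IsChoice φ → ¬ AcyclicOn (C.F φ) univ
  connected : ∀ B : Set V, B.Nonempty → Bᶜ.Nonempty → ∃ a ∈ B, ∃ b ∉ B, A a b ∨ A b a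

variable {k : ℕ}

theorem IsCritical.reverse (hC : C.IsCritical k) : C.reverse.IsCritical k where
  out_le := hC.in_le
  in_le := hC.out_le
  le_card := hC.le_card
  not_acyclic := fun φ hφ h => hC.not_acyclic φ hφ h.swap
  connected := fun B h h' => by
    obtain ⟨a, ha, b, hb, hab⟩ := hC.connected B h h'
    exact ⟨a, ha, b, hb, hab.symm⟩

/-- Greedy extension: if every nonempty set of uncolored vertices outside `R` has an uncolored
neighbour outside it, then an acyclic choice on `S` extends to the complement of `R`. -/
theorem IsCritical.extend [Finite V] (hC : C.IsCritical k) (R : Set V) (hφ : C.IsChoice φ)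
    (hS : AcyclicOn (C.F φ) S)
    (hcut : ∀ B : Set V, B.Nonempty → (∀ b ∈ B, b ∉ S ∧ b ∉ R) →
      ∃ a ∈ B, ∃ b, b ∉ B ∧ b ∉ S ∧ (A a b ∨ A b a)) :
    ∃ ψ, C.IsChoice ψ ∧ (∀ a ∈ S, ψ a = φ a) ∧ AcyclicOn (C.F ψ) Rᶜ := by
  induction hn : ((S ∪ R)ᶜ).ncard generalizing R with
  | zero =>
    rw [ncard_eq_zero (toFinite _), compl_empty_iff] at hn
    refine ⟨φ, hφ, fun _ _ => rfl, hS.mono (fun a ha => ?_) fun _ _ _ _ h => h⟩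
    have h1 : a ∈ S ∪ R := by rw [hn]; trivial
    exact h1.resolve_right ha
  | succ n ih =>
    have hne : ((S ∪ R)ᶜ).Nonempty := nonempty_of_ncard_ne_zero (by omega)
    obtain ⟨a, ha, b, hb, hbS, hab⟩ := hcut _ hne fun b hb =>
      ⟨fun h => hb (.inl h), fun h => hb (.inr h)⟩
    have hbR : b ∈ R := by
      by_contra hbR
      exact hb fun h => h.elim hbS hbR
    have haS : a ∉ S := fun h => ha (.inl h)
    have haR : a ∉ R := fun h => ha (.inr h)
    -- `a` is coloured last. Its neighbour `b` lies in `R` and stays uncoloured, so fewer than `k`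
    -- of its out-neighbours, or of its in-neighbours, are coloured.
    obtain ⟨ψ, hψ, heq, hac⟩ := ih (insert a R)
      (fun B hB hB' => hcut B hB fun b hb => ⟨(hB' b hb).1, fun h => (hB' b hb).2 (.inr h)⟩) (by
        have : (S ∪ insert a R)ᶜ = (S ∪ R)ᶜ \ {a} := by
          ext x; simp; tauto
        rw [this, ncard_sdiff_singleton_of_mem ha, hn]; rfl)
    have hins : insert a (insert a R)ᶜ = Rᶜ := by
      ext x
      by_cases hx : x = a <;> simp [hx, haR]
    have hcount : ∀ N : Set V, b ∈ N → N.ncard ≤ k →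
        {w | w ∈ N ∧ w ∈ (insert a R)ᶜ}.ncard < (C.X a).ncard := by
      intro N hbN hN
      refine (ncard_lt_ncard ?_ (toFinite _)).trans_le (hN.trans (hC.le_card a))
      exact ⟨fun w hw => hw.1, fun h => (h hbN).2 (.inr hbR)⟩
    have hext : ∃ x ∈ C.X a, AcyclicOn (C.F (recolor ψ a x)) (insert a (insert a R)ᶜ) := by
      rcases hab with hab | hab
      · exact exists_recolor_of_out_lt hψ hac (by simp) (hcount {w | A a w} hab (hC.out_le a))
      · exact exists_recolor_of_in_lt hψ hac (by simp) (hcount {w | A w a} hab (hC.in_le a))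
    obtain ⟨x, hx, h1⟩ := hext
    rw [hins] at h1
    refine ⟨_, hψ.recolor hx, fun c hc => ?_, h1⟩
    rw [recolor_of_ne (by rintro rfl; exact haS hc), heq c hc]

variable (C) in
/-- `φ` is a choice that is acyclic away from `v`. -/
structure IsHole (φ : V → W) (v : V) : Prop where
  choice : C.IsChoice φ
  acyclic : AcyclicOn (C.F φ) {v}ᶜ

namespace IsHole

theorem reverse (h : C.IsHole φ v) : C.reverse.IsHole φ v := ⟨h.choice, h.acyclic.swap⟩

theorem recolor {x : W} (h : C.IsHole φ v) (hx : x ∈ C.X v) : C.IsHole (recolor φ v x) v :=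
  ⟨h.choice.recolor hx, h.acyclic.mono subset_rfl fun _ ha _ hb h => (F_recolor ha hb).1 h⟩

/-- A colour of `v` with no arc to a chosen colour would complete an acyclic choice. Hence the
colours inject into the out-neighbours, and k ≤ |X v| ≤ d⁺(v) ≤ k collapses to equalities. -/
theorem out_aux [Finite V] [Finite W] (h : C.IsHole φ v) (hC : C.IsCritical k) :
    ∃ f : W → V, (∀ x ∈ C.X v, A v (f x) ∧ C.H x (φ (f x))) ∧ InjOn f (C.X v) ∧
      f '' C.X v = {w | A v w} ∧ {w | A v w}.ncard = k ∧ (C.X v).ncard = k := by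
  have h1 : ∀ x ∈ C.X v, ∃ w ∈ ({v}ᶜ : Set V), C.H x (φ w) := fun x hx => by
    by_contra! h1
    have := exists_recolor_of_no_out h.choice h.acyclic (by simp) hx h1
    refine hC.not_acyclic _ (h.choice.recolor hx) (this.mono ?_ fun _ _ _ _ h => h)
    intro a _
    exact em (a = v)
  obtain ⟨f, hf, hinj⟩ := exists_out_choice h.choice h1
  have hsub : f '' C.X v ⊆ {w | A v w} := by
    rintro _ ⟨x, hx, rfl⟩
    exact (hf x hx).2.1
  have hcard := hinj.ncard_image
  have h2 := ncard_le_ncard hsub (toFinite _)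
  have h3 := hC.out_le v
  have h4 := hC.le_card v
  refine ⟨f, fun x hx => (hf x hx).2, hinj, ?_, by omega, by omega⟩
  exact eq_of_subset_of_ncard_le hsub (by omega) (toFinite _)

variable [Finite V] [Finite W]

theorem outDeg_eq (h : C.IsHole φ v) (hC : C.IsCritical k) : {w | A v w}.ncard = k :=
  let ⟨_, _, _, _, h, _⟩ := h.out_aux hC; h

theorem card_eq (h : C.IsHole φ v) (hC : C.IsCritical k) : (C.X v).ncard = k :=
  let ⟨_, _, _, _, _, h⟩ := h.out_aux hC; h

theorem exists_color_out (h : C.IsHole φ v) (hC : C.IsCritical k) (hvw : A v w) :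
    ∃ x ∈ C.X v, C.H x (φ w) := by
  obtain ⟨f, hf, _, him, _⟩ := h.out_aux hC
  obtain ⟨x, hx, rfl⟩ := him.ge hvw
  exact ⟨x, hx, (hf x hx).2⟩

theorem exists_color_in (h : C.IsHole φ v) (hC : C.IsCritical k) (hvw : A w v) :
    ∃ x ∈ C.X v, C.H (φ w) x :=
  h.reverse.exists_color_out hC.reverse hvw

theorem exists_out (h : C.IsHole φ v) (hC : C.IsCritical k) : ∃ w, C.F φ v w := by
  obtain ⟨f, hf, _⟩ := h.out_aux hC
  exact ⟨_, (hf _ (h.choice v)).2⟩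

theorem out_unique {w' : V} (h : C.IsHole φ v) (hC : C.IsCritical k) (hw : C.F φ v w)
    (hw' : C.F φ v w') : w = w' := by
  obtain ⟨f, hf, _, him, _⟩ := h.out_aux hC
  have key : ∀ w, C.F φ v w → w = f (φ v) := by
    intro w hw
    obtain ⟨x, hx, rfl⟩ := him.ge (h.choice.adj hw)
    rw [C.in_unique hx (h.choice v) (h.choice _) (hf x hx).2 hw]
  rw [key w hw, key w' hw']

theorem exists_in (h : C.IsHole φ v) (hC : C.IsCritical k) : ∃ w, C.F φ w v :=
  h.reverse.exists_out hC.reverse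

theorem in_unique {w' : V} (h : C.IsHole φ v) (hC : C.IsCritical k) (hw : C.F φ w v)
    (hw' : C.F φ w' v) : w = w' :=
  h.reverse.out_unique hC.reverse hw hw'

/-- `w` is the only chosen out-neighbour of `v`, so once `w` is left out, `v` has no successor and
can be put back without closing a cycle. -/
theorem succ (h : C.IsHole φ v) (hC : C.IsCritical k) (hvw : C.F φ v w) : C.IsHole φ w := by
  refine ⟨h.choice, ?_⟩
  have h1 : AcyclicOn (C.F φ) ({v, w}ᶜ) :=
    h.acyclic.mono (fun a ha h => ha (.inl h)) fun _ _ _ _ h => h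
  refine (h1.insert_of_no_out (v := v) ?_).mono (S' := insert v {v, w}ᶜ) ?_ fun _ _ _ _ h => h
  · rintro u (rfl | hu) hvu
    · exact h.choice.ne hvu rfl
    · exact hu (.inr (h.out_unique hC hvu hvw))
  · intro a ha
    by_cases hav : a = v
    · exact .inl hav
    · exact .inr (by simpa [hav] using ha)

theorem pred (h : C.IsHole φ v) (hC : C.IsCritical k) (hvw : C.F φ w v) : C.IsHole φ w :=
  (h.reverse.succ hC.reverse hvw).reverse

theorem of_reflTransGen (h : C.IsHole φ v) (hC : C.IsCritical k)
    (hu : ReflTransGen (C.F φ) v u) : C.IsHole φ u := by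
  induction hu with
  | refl => exact h
  | tail _ h1 ih => exact ih.succ hC h1

-- Criticality provides a closed walk, which must pass through `v` because the choice is acyclic
-- elsewhere; `key` cuts the walk at `v`.
omit [Finite V] [Finite W] in
theorem transGen_self (h : C.IsHole φ v) (hC : C.IsCritical k) : TransGen (C.F φ) v v := by
  have key : ∀ a b, TransGen (C.F φ) a b →
      TransGen (fun a b => a ∈ ({v}ᶜ : Set V) ∧ b ∈ ({v}ᶜ : Set V) ∧ C.F φ a b) a b ∨
      (ReflTransGen (C.F φ) a v ∧ ReflTransGen (C.F φ) v b) := by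
    intro a b hab
    induction hab with
    | @single b h1 =>
      by_cases ha : a = v
      · subst ha; exact .inr ⟨.refl, .single h1⟩
      by_cases hb : b = v
      · subst hb; exact .inr ⟨.single h1, .refl⟩
      exact .inl (.single ⟨ha, hb, h1⟩)
    | @tail b c hab h1 ih =>
      rcases ih with ih | ih
      · by_cases hb : b = v
        · subst hb; exact .inr ⟨hab.to_reflTransGen, .single h1⟩
        by_cases hc : c = v
        · subst hc; exact .inr ⟨hab.to_reflTransGen.tail h1, .refl⟩
        exact .inl (ih.tail ⟨hb, hc, h1⟩)
      · exact .inr ⟨ih.1, ih.2.tail h1⟩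
  have h1 := hC.not_acyclic φ h.choice
  simp only [AcyclicOn, mem_univ, true_and, not_forall, not_not] at h1
  obtain ⟨a, ha⟩ := h1
  rcases key a a ha with h2 | h2
  · exact (h.acyclic a h2).elim
  · exact (TransGen.trans_right h2.2 ha).trans_left h2.1

/-- Each reached vertex is again a hole, so its successor is unique and the closed walk at `v` has
to run through it. -/
theorem transGen_of_reflTransGen (h : C.IsHole φ v) (hC : C.IsCritical k)
    (hu : ReflTransGen (C.F φ) v u) : TransGen (C.F φ) u v := by
  induction hu with
  | refl => exact h.transGen_self hC
  | @tail u w hvu h1 ih =>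
    obtain ⟨w', h2, h3⟩ := TransGen.head'_iff.1 ih
    obtain rfl := (h.of_reflTransGen hC hvu).out_unique hC h1 h2
    rcases reflTransGen_iff_eq_or_transGen.1 h3 with rfl | h3
    · exact h.transGen_self hC
    · exact h3

theorem reflTransGen_pred (h : C.IsHole φ v) (hC : C.IsCritical k)
    (hu : ReflTransGen (C.F φ) v u) (hw : C.F φ w u) : ReflTransGen (C.F φ) v w := by
  have h1 : TransGen (C.F φ) v u := (h.transGen_self hC).trans_left hu
  obtain ⟨w', h2, h3⟩ := TransGen.tail'_iff.1 h1
  rwa [(h.of_reflTransGen hC hu).in_unique hC hw h3]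

/-- The closed walk through a hole is an induced subdigraph. -/
theorem F_of_adj (h : C.IsHole φ v) (hC : C.IsCritical k) (hu : ReflTransGen (C.F φ) v u)
    (hw : ReflTransGen (C.F φ) v w) (huw : A u w) : C.F φ u w := by
  have hole := h.of_reflTransGen hC hu
  have hne : w ≠ u := by
    rintro rfl
    exact C.irrefl _ huw
  -- Recolour `u` so that it points at `w`. If the old predecessor `p` of `w` were not `u`, the hole
  -- `w` would now have two predecessors.
  obtain ⟨x, hx, hxw⟩ := hole.exists_color_out hC huw
  have hw' : C.F (Digraph.recolor φ u x) u w := (F_recolor_left hne).2 hxw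
  obtain ⟨p, hp⟩ := (h.of_reflTransGen hC hw).exists_in hC
  by_cases hpu : p = u
  · rwa [← hpu]
  · have h1 := (hole.recolor hx).succ hC hw'
    exact (hpu (h1.in_unique hC ((F_recolor hpu hne).2 hp) hw')).elim

end IsHole

theorem IsCritical.exists_isHole [Finite V] [Finite W] (hC : C.IsCritical k) (hk : 0 < k) (v : V) :
    ∃ φ, C.IsHole φ v := by
  have h0 : ∀ v, (C.X v).Nonempty := fun v =>
    nonempty_of_ncard_ne_zero (hk.trans_le (hC.le_card v)).ne'
  choose φ hφ using h0
  obtain ⟨ψ, hψ, _, hac⟩ := hC.extend {v} hφ (acyclicOn_empty _) (S := ∅) fun B hB hB' => by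
    obtain ⟨a, ha, b, hb, hab⟩ := hC.connected B hB ⟨v, fun hv => (hB' v hv).2 rfl⟩
    exact ⟨a, ha, b, hb, by simp, hab⟩
  exact ⟨ψ, hψ, hac⟩

end ArcCover
end Digraph

/-! ### Moving the hole while a set keeps its colours. -/

namespace Digraph
open Relation Set
variable {V W : Type u}
namespace ArcCover
variable {A : V → V → Prop} {C : ArcCover A W} {φ ψ : V → W} {u v w q q' : V} {P : Set V} {k : ℕ}

variable (C) in
/-- `φ` is a hole at `q`, and away from `q` no arc chosen by `φ` joins `P` to its complement. -/
structure Isolates (φ : V → W) (q : V) (P : Set V) : Prop where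
  hole : C.IsHole φ q
  notMem : q ∉ P
  isolated : ∀ p ∈ P, ∀ u ∉ P, u ≠ q → ¬ C.F φ u p ∧ ¬ C.F φ p u

theorem Isolates.reverse (h : C.Isolates φ q P) : C.reverse.Isolates φ q P :=
  ⟨h.hole.reverse, h.notMem, fun p hp u hu huq => (h.isolated p hp u hu huq).symm⟩

variable [Finite V] [Finite W]

/-- Recolour `q` so that it points at `q'`, then push the hole there. The closed walk goes from `q`
to `q'`, outside `P`, and no other vertex outside `P` is joined to `P`; so it never meets `P`, and
the newly filled `q` has no arc to or from `P`. -/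
theorem Isolates.move_out (h : C.Isolates φ q P) (hC : C.IsCritical k) (hq' : q' ∉ P)
    (hA : A q q') : ∃ ψ, C.Isolates ψ q' P ∧ EqOn ψ φ P := by
  have hne : q' ≠ q := by
    rintro rfl
    exact C.irrefl _ hA
  obtain ⟨x, hx, hxq⟩ := h.hole.exists_color_out hC hA
  have hole := h.hole.recolor hx
  have hF : C.F (recolor φ q x) q q' := (F_recolor_left hne).2 hxq
  have hPq : ∀ p ∈ P, p ≠ q := fun p hp hpq => h.notMem (hpq ▸ hp)
  have horb : ∀ w, ReflTransGen (C.F (recolor φ q x)) q w → w ∉ P := by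
    intro w hw
    induction hw with
    | refl => exact h.notMem
    | @tail w w' _ h1 ih =>
      intro hw'
      by_cases hwq : w = q
      · subst hwq
        exact hq' (hole.out_unique hC hF h1 ▸ hw')
      · exact (h.isolated w' hw' w ih hwq).1 ((F_recolor hwq (hPq w' hw')).1 h1)
  refine ⟨recolor φ q x, ⟨hole.succ hC hF, hq', fun p hp u hu huq' => ?_⟩, fun p hp =>
    recolor_of_ne (hPq p hp)⟩
  by_cases huq : u = q
  · subst huq
    exact ⟨fun h1 => hq' (hole.out_unique hC hF h1 ▸ hp),
      fun h1 => horb p (hole.reflTransGen_pred hC .refl h1) hp⟩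
  · rw [F_recolor huq (hPq p hp), F_recolor (hPq p hp) huq]
    exact h.isolated p hp u hu huq

theorem Isolates.move (h : C.Isolates φ q P) (hC : C.IsCritical k) (hq' : q' ∉ P)
    (hA : A q q' ∨ A q' q) : ∃ ψ, C.Isolates ψ q' P ∧ EqOn ψ φ P := by
  rcases hA with hA | hA
  · exact h.move_out hC hq' hA
  · obtain ⟨ψ, h1, h2⟩ := h.reverse.move_out hC.reverse hq' hA
    exact ⟨ψ, h1.reverse, h2⟩

variable (C) in
/-- The closed walk through the hole `v`, without `v`. -/
def orbit (φ : V → W) (v : V) : Set V := {u | ReflTransGen (C.F φ) v u ∧ u ≠ v}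

theorem IsHole.isolates_orbit (h : C.IsHole φ v) (hC : C.IsCritical k) :
    C.Isolates φ v (C.orbit φ v) := by
  refine ⟨h, fun h => h.2 rfl, fun p hp u hu huv => ⟨fun h1 => hu ⟨?_, huv⟩,
    fun h1 => hu ⟨hp.1.tail h1, huv⟩⟩⟩
  exact h.reflTransGen_pred hC hp.1 h1

/-- A hole away from a closed walk of length at least three is not adjacent to it. -/
theorem IsHole.not_adj_orbit {s t : V} (h : C.IsHole φ v) (hC : C.IsCritical k)
    (hs : C.F φ v s) (ht : C.F φ t v) (hst : s ≠ t) (hψ : C.Isolates ψ q (C.orbit φ v))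
    (heq : EqOn ψ φ (C.orbit φ v)) (hqv : q ≠ v) {p : V} (hp : p ∈ C.orbit φ v) :
    ¬ (A q p ∨ A p q) := by
  intro hA
  have hPq : ∀ p ∈ C.orbit φ v, p ≠ q := fun p hp hpq => hψ.notMem (hpq ▸ hp)
  -- Colour `q` so that its closed walk passes through `p`.
  have hcol : ∃ x ∈ C.X q, ReflTransGen (C.F (Digraph.recolor ψ q x)) q p := by
    rcases hA with hA | hA
    · obtain ⟨x, hx, hxp⟩ := hψ.hole.exists_color_out hC hA
      exact ⟨x, hx, .single ((F_recolor_left (hPq p hp)).2 hxp)⟩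
    · obtain ⟨x, hx, hxp⟩ := hψ.hole.exists_color_in hC hA
      exact ⟨x, hx, (hψ.hole.recolor hx).reflTransGen_pred hC .refl
        ((F_recolor_right (hPq p hp)).2 hxp)⟩
  obtain ⟨x, hx, hqp⟩ := hcol
  have hole := hψ.hole.recolor hx
  have hF : ∀ a ∈ C.orbit φ v, ∀ b ∈ C.orbit φ v,
      (C.F (Digraph.recolor ψ q x) a b ↔ C.F φ a b) := by
    intro a ha b hb
    rw [F_recolor (hPq a ha) (hPq b hb), F, F, heq ha, heq hb]
  have hsv : s ≠ v := fun h1 => h.choice.ne hs h1.symm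
  have htv : t ≠ v := h.choice.ne ht
  have hsP : s ∈ C.orbit φ v := ⟨.single hs, hsv⟩
  have htP : t ∈ C.orbit φ v := ⟨h.reflTransGen_pred hC .refl ht, htv⟩
  -- Inside the orbit the chosen arcs are the old ones: following them back from `p` leads to `s`,
  -- and below, forward to `t`. So the hole can be moved to either.
  have hsorb : ReflTransGen (C.F (Digraph.recolor ψ q x)) q s := by
    have key : ∀ a, ReflTransGen (C.F φ) v a → a ≠ v →
        ReflTransGen (C.F (Digraph.recolor ψ q x)) q a →
        ReflTransGen (C.F (Digraph.recolor ψ q x)) q s := by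
      intro a ha
      induction ha with
      | refl => exact fun h => (h rfl).elim
      | @tail a b hva hab ih =>
        intro hbv hqb
        by_cases hav : a = v
        · subst hav
          rwa [h.out_unique hC hs hab]
        · exact ih hav (hole.reflTransGen_pred hC hqb
            ((hF a ⟨hva, hav⟩ b ⟨hva.tail hab, hbv⟩).2 hab))
    exact key p hp.1 hp.2 hqp
  have htorb : ReflTransGen (C.F (Digraph.recolor ψ q x)) q t := by
    have key : ∀ a, ReflTransGen (C.F φ) a v → ReflTransGen (C.F φ) v a → a ≠ v →
        ReflTransGen (C.F (Digraph.recolor ψ q x)) q a →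
        ReflTransGen (C.F (Digraph.recolor ψ q x)) q t := by
      intro a ha
      induction ha using ReflTransGen.head_induction_on with
      | refl => exact fun _ h => (h rfl).elim
      | @head a b hab hbv' ih =>
        intro hva hav hqa
        by_cases hbv : b = v
        · subst hbv
          rwa [h.in_unique hC ht hab]
        · exact ih (hva.tail hab) hbv
            (hqa.tail ((hF a ⟨hva, hav⟩ b ⟨hva.tail hab, hbv⟩).2 hab))
    exact key p (h.transGen_of_reflTransGen hC hp.1).to_reflTransGen hp.1 hp.2 hqp
  -- The orbit is induced, so an arc from `v` to `t` would be a second chosen arc out of `v`.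
  have hvt : ¬ A v t := fun h1 =>
    hst (h.out_unique hC hs (h.F_of_adj hC .refl htP.1 h1))
  have hole_t := hole.of_reflTransGen hC htorb
  have hole_s := hole.of_reflTransGen hC hsorb
  -- Moving the hole through `t` into `v` shows that `v` has a chosen successor `r ≠ t`. Moving it
  -- through `s` instead gives `v` the successor `s`, while `r` remains one if `r ≠ s`, against
  -- uniqueness. The case `r = s` violates isolation.
  obtain ⟨y, hy, hyv⟩ := hole_t.exists_color_out hC (h.choice.adj ht)
  have h1 := (hole_t.recolor hy).succ hC ((F_recolor_left htv.symm).2 hyv)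
  obtain ⟨r, hr⟩ := h1.exists_out hC
  have hrt : r ≠ t := by
    rintro rfl
    exact hvt (h1.choice.adj hr)
  rw [F_recolor htv.symm hrt] at hr
  obtain ⟨z, hz, hvz⟩ := hole_s.exists_color_in hC (h.choice.adj hs)
  have hvs : C.F (Digraph.recolor (Digraph.recolor ψ q x) s z) v s :=
    (F_recolor_right hsv.symm).2 hvz
  have h2 := (hole_s.recolor hz).pred hC hvs
  by_cases hrs : r = s
  · subst hrs
    rw [F_recolor hqv.symm (hPq _ hsP)] at hr
    exact (hψ.isolated _ hsP v (fun h => h.2 rfl) hqv.symm).1 hr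
  · exact hrs (h2.out_unique hC ((F_recolor hsv.symm hrs).2 hr) hvs)

variable (A) in
/-- The vertices reachable from `v` in the underlying graph without entering `P`. -/
def reach (P : Set V) (v : V) : Set V :=
  {w | ReflTransGen (fun a b => (A a b ∨ A b a) ∧ b ∉ P) v w}

theorem Isolates.exists_of_mem_reach (h : C.Isolates φ q P) (hC : C.IsCritical k)
    (hw : w ∈ reach A P q) : ∃ ψ, C.Isolates ψ w P ∧ EqOn ψ φ P := by
  induction hw with
  | refl => exact ⟨φ, h, eqOn_refl _ _⟩
  | tail _ h1 ih =>
    obtain ⟨ψ, h2, h3⟩ := ih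
    obtain ⟨ψ', h4, h5⟩ := h2.move hC h1.2 h1.1
    exact ⟨ψ', h4, h5.trans h3⟩

variable (C) in
/-- `v` is a hole of `φ` on a closed walk of length at least three. -/
def IsLongHole (φ : V → W) (v : V) : Prop :=
  C.IsHole φ v ∧ ∃ s t, C.F φ v s ∧ C.F φ t v ∧ s ≠ t

/-- The hole can travel to `u` without changing colours on the orbit, and there `not_adj_orbit`
applies. So `v` is the only vertex of its reach with neighbours on the orbit. -/
theorem IsLongHole.mem_reach_of_adj (h : C.IsLongHole φ v) (hC : C.IsCritical k)
    (hu : u ∈ reach A (C.orbit φ v) v) (huv : u ≠ v) (hA : A u w ∨ A w u) :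
    w ∈ reach A (C.orbit φ v) v := by
  obtain ⟨h, s, t, hs, ht, hst⟩ := h
  obtain ⟨ψ, h1, h2⟩ := (h.isolates_orbit hC).exists_of_mem_reach hC hu
  exact ReflTransGen.tail hu
    ⟨hA, fun hw => h.not_adj_orbit hC hs ht hst h1 h2 huv hw hA⟩

theorem IsHole.mem_orbit_iff (h : C.IsHole φ v) (hC : C.IsCritical k)
    (hu : ReflTransGen (C.F φ) v u) : w ∈ C.orbit φ u ↔ ReflTransGen (C.F φ) v w ∧ w ≠ u :=
  ⟨fun hw => ⟨hu.trans hw.1, hw.2⟩,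
    fun hw => ⟨(h.transGen_of_reflTransGen hC hu).to_reflTransGen.trans hw.1, hw.2⟩⟩

/-- An arc without opposite arc lies on a closed walk of length at least three. -/
theorem IsCritical.exists_isLongHole {a b : V} (hC : C.IsCritical k) (hk : 0 < k) (hab : A a b)
    (hba : ¬ A b a) : ∃ φ, C.IsLongHole φ a ∧ C.IsLongHole φ b ∧ C.F φ a b := by
  obtain ⟨φ, hφ⟩ := hC.exists_isHole hk b
  obtain ⟨x, hx, hxa⟩ := hφ.exists_color_in hC hab
  have hne : a ≠ b := by
    rintro rfl
    exact hba hab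
  have hF : C.F (recolor φ b x) a b := (F_recolor_right hne).2 hxa
  have hb := hφ.recolor hx
  have ha := hb.pred hC hF
  obtain ⟨s, hs⟩ := hb.exists_out hC
  obtain ⟨t, ht⟩ := ha.exists_in hC
  refine ⟨_, ⟨ha, b, t, hF, ht, ?_⟩, ⟨hb, s, a, hs, hF, ?_⟩, hF⟩
  · rintro rfl
    exact hba (ha.choice.adj ht)
  · rintro rfl
    exact hba (ha.choice.adj hs)

/-- If some arc has no opposite arc, then there is a long hole `v` such that opposite arcs exist
throughout the part of the digraph attached at `v`. -/
theorem IsCritical.exists_bidirected_reach (hC : C.IsCritical k) (hk : 0 < k)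
    (h : ∃ a b, A a b ∧ ¬ A b a) : ∃ φ v, C.IsLongHole φ v ∧
      ∀ a ∈ reach A (C.orbit φ v) v, ∀ b ∈ reach A (C.orbit φ v) v, A a b → A b a := by
  have hex : ∃ n φ v, C.IsLongHole φ v ∧ (reach A (C.orbit φ v) v).ncard = n := by
    obtain ⟨a, b, hab, hba⟩ := h
    obtain ⟨φ, h1, -⟩ := hC.exists_isLongHole hk hab hba
    exact ⟨_, φ, a, h1, rfl⟩
  classical
  -- A long hole with the smallest possible reach.
  obtain ⟨φ, v, hv, hn⟩ := Nat.find_spec hex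
  refine ⟨φ, v, hv, fun a ha b hb hab => ?_⟩
  by_contra hba
  obtain ⟨ψ, hla, hlb, hF⟩ := hC.exists_isLongHole hk hab hba
  have hne : a ≠ b := by
    rintro rfl
    exact hba hab
  -- One of `a`, `b` is a long hole whose reach misses `v`; that reach is then strictly smaller,
  -- against minimality.
  have key : ∃ u ∈ reach A (C.orbit φ v) v, u ≠ v ∧ C.IsLongHole ψ u ∧
      v ∉ reach A (C.orbit ψ u) u := by
    have hnot : ∀ {P : Set V} {u : V}, v ∈ P → v ≠ u → v ∉ reach A P u := by
      intro P u hvP hvu h1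
      rcases ReflTransGen.cases_tail h1 with h1 | ⟨_, _, h1⟩
      · exact hvu h1
      · exact h1.2 hvP
    have horb : ∀ w, w ∈ C.orbit ψ b ↔ ReflTransGen (C.F ψ) a w ∧ w ≠ b :=
      fun w => hla.1.mem_orbit_iff hC (.single hF)
    by_cases hav : a = v
    · subst hav
      exact ⟨b, hb, hne.symm, hlb, hnot ((horb _).2 ⟨.refl, hne⟩) hne⟩
    by_cases hbv : b = v
    · subst hbv
      exact ⟨a, ha, hav, hla, hnot ⟨.single hF, hne.symm⟩ hne.symm⟩
    by_cases hva : v ∈ reach A (C.orbit ψ a) a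
    · refine ⟨b, hb, hbv, hlb, fun hvb => ?_⟩
      have hbo : b ∈ C.orbit ψ a := ⟨.single hF, hne.symm⟩
      -- A walk from `b` to `v` off the orbit of `b` avoids `a`. Traced back from `v`, it cannot
      -- leave the reach of `a`, so it would put `b` there, although `b` is on the orbit of `a`.
      have haux : ∀ w, ReflTransGen (fun x y => (A x y ∨ A y x) ∧ y ∉ C.orbit ψ b) w v →
          w ∉ C.orbit ψ b → w ∈ reach A (C.orbit ψ a) a ∧ w ≠ a := by
        intro w hw
        induction hw using ReflTransGen.head_induction_on with
        | refl => exact fun _ => ⟨hva, Ne.symm hav⟩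
        | @head w w' h1 _ ih =>
          intro hw
          obtain ⟨h3, h4⟩ := ih h1.2
          refine ⟨hla.mem_reach_of_adj hC h3 h4 h1.1.symm, ?_⟩
          rintro rfl
          exact hw ((horb _).2 ⟨.refl, hne⟩)
      have h5 := haux b hvb fun h => h.2 rfl
      rcases ReflTransGen.cases_tail h5.1 with h6 | ⟨_, _, h6⟩
      · exact hne h6.symm
      · exact h6.2 hbo
    · exact ⟨a, ha, hav, hla, hva⟩
  obtain ⟨u, hu, huv, hlu, hvu⟩ := key
  have hsub : reach A (C.orbit ψ u) u ⊆ reach A (C.orbit φ v) v \ {v} := by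
    intro w hw
    have hw' : ReflTransGen (fun x y => (A x y ∨ A y x) ∧ y ∉ C.orbit ψ u) u w := hw
    induction hw' with
    | refl => exact ⟨hu, huv⟩
    | @tail w w' h1 h2 ih =>
      obtain ⟨h3, h4⟩ := ih h1
      refine ⟨hv.mem_reach_of_adj hC h3 h4 h2.1, ?_⟩
      rintro rfl
      exact hvu hw
  have hlt : (reach A (C.orbit ψ u) u).ncard < (reach A (C.orbit φ v) v).ncard := by
    refine ncard_lt_ncard ⟨hsub.trans sdiff_subset, fun h1 => ?_⟩ (toFinite _)
    exact (hsub (h1 (ReflTransGen.refl : v ∈ reach A _ v))).2 rfl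
  exact Nat.find_min hex (hlt.trans_eq hn) ⟨ψ, u, hlu, rfl⟩

end ArcCover
end Digraph

/-! ### Paths, forks and Hamiltonian cycles. -/

namespace Digraph
open Relation Set
variable {V W : Type u}

section Lists

theorem exists_boundary_of_isChain {R : V → V → Prop} {L : List V} {B : Set V}
    (hL : L.IsChain fun a b => R a b ∨ R b a) (h1 : ∃ x ∈ L, x ∈ B) (h2 : ∃ x ∈ L, x ∉ B) :
    ∃ a ∈ L, ∃ b ∈ L, a ∈ B ∧ b ∉ B ∧ (R a b ∨ R b a) := by
  induction L with
  | nil => simp at h1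
  | cons x t ih =>
    cases t with
    | nil =>
      simp only [List.mem_singleton, exists_eq_left] at h1 h2
      exact (h2 h1).elim
    | cons y t =>
      rw [List.isChain_cons_cons] at hL
      by_cases hx : x ∈ B <;> by_cases hy : y ∈ B
      · obtain ⟨z, hz, hzB⟩ := h2
        have hzt : z ∈ y :: t := (List.mem_cons.1 hz).resolve_left fun h => hzB (h ▸ hx)
        obtain ⟨a, ha, b, hb, h⟩ := ih hL.2 ⟨y, by simp, hy⟩ ⟨z, hzt, hzB⟩
        exact ⟨a, .tail _ ha, b, .tail _ hb, h⟩
      · exact ⟨x, by simp, y, by simp, hx, hy, hL.1⟩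
      · exact ⟨y, by simp, x, by simp, hy, hx, hL.1.symm⟩
      · obtain ⟨z, hz, hzB⟩ := h1
        have hzt : z ∈ y :: t := (List.mem_cons.1 hz).resolve_left fun h => hx (h ▸ hzB)
        obtain ⟨a, ha, b, hb, h⟩ := ih hL.2 ⟨z, hzt, hzB⟩ ⟨y, by simp, hy⟩
        exact ⟨a, .tail _ ha, b, .tail _ hb, h⟩

theorem exists_last_split {Q : V → Prop} {t : List V} (h : ∃ z ∈ t, Q z) :
    ∃ t₁ z t₂, t = t₁ ++ z :: t₂ ∧ Q z ∧ ∀ y ∈ t₂, ¬ Q y := by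
  induction t with
  | nil => simp at h
  | cons x t ih =>
    by_cases ht : ∃ z ∈ t, Q z
    · obtain ⟨t₁, z, t₂, rfl, h1, h2⟩ := ih ht
      exact ⟨x :: t₁, z, t₂, rfl, h1, h2⟩
    · push Not at ht
      obtain ⟨z, hz, hQ⟩ := h
      rcases List.mem_cons.1 hz with rfl | hz
      · exact ⟨[], z, t, rfl, hQ, ht⟩
      · exact (ht z hz hQ).elim

theorem exists_first_split {Q : V → Prop} {t : List V} {h : V} (hh : ¬ Q h)
    (ht : ∃ z ∈ t, Q z) : ∃ p a b q, h :: t = p ++ a :: b :: q ∧ ¬ Q a ∧ Q b := by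
  induction t generalizing h with
  | nil => simp at ht
  | cons x t ih =>
    by_cases hx : Q x
    · exact ⟨[], h, x, t, rfl, hh, hx⟩
    · obtain ⟨z, hz, hQ⟩ := ht
      obtain ⟨p, a, b, q, h1, h2⟩ := ih hx
        ⟨z, (List.mem_cons.1 hz).resolve_left fun h => hx (h ▸ hQ), hQ⟩
      exact ⟨h :: p, a, b, q, by rw [h1]; rfl, h2⟩

/-- Among the lists without repetition satisfying `Q`, one cannot be extended at its head. -/
theorem exists_maximal_list [Finite V] {Q : List V → Prop} (hQ : ∀ l, Q l → l.Nodup)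
    {l₀ : List V} (h₀ : Q l₀) : ∃ l, Q l ∧ ∀ x, ¬ Q (x :: l) := by
  by_contra! hcon
  have key : ∀ n : ℕ, ∃ l, Q l ∧ n ≤ l.length := by
    intro n
    induction n with
    | zero => exact ⟨l₀, h₀, Nat.zero_le _⟩
    | succ n ih =>
      obtain ⟨l, h1, h2⟩ := ih
      obtain ⟨x, hx⟩ := hcon l h1
      exact ⟨_, hx, by simpa using h2⟩
  have := Fintype.ofFinite V
  obtain ⟨l, h1, h2⟩ := key (Fintype.card V + 1)
  have := (hQ l h1).length_le_card
  omega

end Lists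

namespace ArcCover
variable {A : V → V → Prop} {C : ArcCover A W} {φ ψ : V → W} {k : ℕ}
variable [Finite V] [Finite W]

/-- In a critical cover, one cannot precolor an out-neighbour `u` of `b` and leave a neighbour `a`
of `b` free, if all remaining vertices can be colored greedily towards `b`. -/
theorem IsCritical.no_fork_out (hC : C.IsCritical k) (hk : 0 < k) {a b u : V} {S : Set V}
    (hba : A b a) (hbu : A b u) (huS : u ∈ S) (haS : a ∉ S) (hbS : b ∉ S)
    (hφ : C.IsChoice φ) (hS : AcyclicOn (C.F φ) S) (haw : ∀ w ∈ S, ¬ A a w)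
    (hcut : ∀ B : Set V, B.Nonempty → (∀ c ∈ B, c ∉ S ∧ c ≠ a ∧ c ≠ b) →
      ∃ c ∈ B, ∃ d, d ∉ B ∧ d ∉ S ∧ d ≠ a ∧ (A c d ∨ A d c)) : False := by
  have hab : a ≠ b := by
    rintro rfl
    exact C.irrefl _ hba
  have hua : u ≠ a := by
    rintro rfl
    exact haS huS
  have hub : u ≠ b := by
    rintro rfl
    exact hbS huS
  -- As `a` has no arc into `S`, it accepts every colour; greedy colouring then leaves a hole at
  -- `b`, with `u` unchanged.
  have key : ∀ y ∈ C.X a, ∃ ψ, C.IsHole ψ b ∧ ψ a = y ∧ ψ u = φ u := by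
    intro y hy
    have h1 : AcyclicOn (C.F (recolor φ a y)) (insert a S) :=
      exists_recolor_of_no_out hφ hS haS hy fun w hw h => haw w hw (C.proj hy (hφ w) h)
    obtain ⟨ψ, h2, h3, h4⟩ := hC.extend {b} (hφ.recolor hy) h1 fun B hB hB' => by
      obtain ⟨c, hc, d, h5, h6, h7, h8⟩ := hcut B hB fun c hc =>
        ⟨fun h => (hB' c hc).1 (.inr h), fun h => (hB' c hc).1 (.inl h), (hB' c hc).2⟩
      exact ⟨c, hc, d, h5, fun h => h.elim h7 h6, h8⟩
    refine ⟨ψ, ⟨h2, h4⟩, ?_, ?_⟩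
    · rw [h3 a (.inl rfl), recolor_self]
    · rw [h3 u (.inr huS), recolor_of_ne hua]
  have hx : ∃ x ∈ C.X b, C.H x (φ u) := by
    obtain ⟨ψ, h1, -, h3⟩ := key _ (hφ a)
    obtain ⟨x, hx, h4⟩ := h1.exists_color_out hC hbu
    exact ⟨x, hx, h3 ▸ h4⟩
  obtain ⟨x, hx, hxu⟩ := hx
  have hg : ∀ y ∈ C.X a, ∃ x ∈ C.X b, C.H x y := by
    intro y hy
    obtain ⟨ψ, h1, h2, -⟩ := key y hy
    obtain ⟨x, hx, h4⟩ := h1.exists_color_out hC hba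
    exact ⟨x, hx, h2 ▸ h4⟩
  have hW : Nonempty W := ⟨x⟩
  choose! g hgX hgH using hg
  have hinj : InjOn g (C.X a) := fun y hy y' hy' h =>
    C.out_unique (hgX y hy) hy hy' (hgH y hy) (h ▸ hgH y' hy')
  have hcard : ∀ v, (C.X v).ncard = k := fun v =>
    let ⟨_, h⟩ := hC.exists_isHole hk v
    h.card_eq hC
  have him : g '' C.X a = C.X b := by
    refine eq_of_subset_of_ncard_le ?_ ?_ (toFinite _)
    · rintro _ ⟨y, hy, rfl⟩
      exact hgX y hy
    · rw [hinj.ncard_image, hcard, hcard]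
  -- The injection `g` between two sets of size `k` is onto, so the colour of `b` pointing at `φ u`
  -- also points at a colour `y` of `a`. With `y` on `a`, the hole `b` gets two successors.
  obtain ⟨y, hy, rfl⟩ := him.ge hx
  obtain ⟨ψ, h1, h2, h3⟩ := key y hy
  refine hua ((h1.recolor hx).out_unique hC ((F_recolor_left hub).2 ?_)
    ((F_recolor_left hab).2 ?_))
  · rwa [h3]
  · rw [h2]
    exact hgH y hy

theorem IsCritical.no_fork (hC : C.IsCritical k) (hk : 0 < k) {a b u : V} {S : Set V}
    (hab : A a b) (hba : A b a) (hbu : A b u ∨ A u b) (huS : u ∈ S) (haS : a ∉ S) (hbS : b ∉ S)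
    (hφ : C.IsChoice φ) (hS : AcyclicOn (C.F φ) S) (haw : ∀ w ∈ S, ¬ (A a w ∨ A w a))
    (hcut : ∀ B : Set V, B.Nonempty → (∀ c ∈ B, c ∉ S ∧ c ≠ a ∧ c ≠ b) →
      ∃ c ∈ B, ∃ d, d ∉ B ∧ d ∉ S ∧ d ≠ a ∧ (A c d ∨ A d c)) : False := by
  rcases hbu with hbu | hbu
  · exact hC.no_fork_out hk hba hbu huS haS hbS hφ hS (fun w hw h => haw w hw (.inl h)) hcut
  · refine hC.reverse.no_fork_out hk hab hbu huS haS hbS hφ hS.swap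
      (fun w hw h => haw w hw (.inr h)) fun B hB hB' => ?_
    obtain ⟨c, hc, d, h5, h6, h7, h8⟩ := hcut B hB hB'
    exact ⟨c, hc, d, h5, h6, h7, h8.symm⟩

/-- Let `h :: t` be a path with opposite arcs throughout that contains all neighbours of its
head. Then an initial segment of it is a Hamiltonian cycle. -/
theorem IsCritical.exists_hamiltonian (hC : C.IsCritical k) (hk : 0 < k) {h : V} {t : List V}
    (hnd : (h :: t).Nodup) (hch : (h :: t).IsChain fun a b => A a b ∨ A b a)
    (hN : ∀ w, A h w ∨ A w h → w ∈ h :: t)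
    (hdig : ∀ a ∈ h :: t, ∀ b ∈ h :: t, A a b → A b a) :
    ∃ t₁ z t₂, t = t₁ ++ z :: t₂ ∧ (A h z ∨ A z h) ∧ ∀ v, v ∈ h :: (t₁ ++ [z]) := by
  have hz : ∃ z ∈ t, A h z ∨ A z h := by
    obtain ⟨φ, hφ⟩ := hC.exists_isHole hk h
    obtain ⟨z, hz⟩ := hφ.exists_out hC
    have hA := hφ.choice.adj hz
    refine ⟨z, (List.mem_cons.1 (hN z (.inl hA))).resolve_left ?_, .inl hA⟩
    rintro rfl
    exact C.irrefl _ hA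
  -- Cutting at the last neighbour of `h` closes a cycle that contains all neighbours of `h`.
  obtain ⟨t₁, z, t₂, rfl, hz, hlast⟩ := exists_last_split hz
  refine ⟨t₁, z, t₂, rfl, hz, ?_⟩
  by_contra! hcon
  have hsplit : h :: (t₁ ++ z :: t₂) = (h :: (t₁ ++ [z])) ++ t₂ := by simp
  rw [hsplit] at hnd hch hN hdig
  generalize hZ : h :: (t₁ ++ [z]) = Z at *
  have hhZ : h ∈ Z := by simp [← hZ]
  obtain ⟨b', hb', u', hu', hbu'⟩ := hC.connected {v | v ∈ Z} ⟨h, hhZ⟩ hcon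
  have hnh : ¬ ∃ u ∉ Z, A h u ∨ A u h := by
    rintro ⟨u, hu, hA⟩
    rcases List.mem_append.1 (hN u hA) with h1 | h1
    · exact hu h1
    · exact hlast u h1 hA
  have hfirst : ∃ y ∈ t₁ ++ [z], ∃ u ∉ Z, A y u ∨ A u y := by
    refine ⟨b', ?_, u', hu', hbu'⟩
    have : b' ∈ h :: (t₁ ++ [z]) := hZ ▸ hb'
    refine (List.mem_cons.1 this).resolve_left ?_
    rintro rfl
    exact hnh ⟨u', hu', hbu'⟩
  -- Consecutive vertices of the cycle: `a` has no neighbour outside it, `b` has one, `u`. This is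
  -- the fork.
  obtain ⟨p, a, b, q, hpq, ha, u, hu, hbu⟩ :=
    exists_first_split (Q := fun y => ∃ u ∉ Z, A y u ∨ A u y) hnh hfirst
  rw [hZ] at hpq
  have hndZ : Z.Nodup := hnd.of_append_left
  have hchZ : Z.IsChain fun a b => A a b ∨ A b a := hch.left_of_append
  have hZlast : Z.getLast? = some z := by
    rw [← hZ, ← List.cons_append, List.getLast?_concat]
  have hZhead : Z.head? = some h := by simp [← hZ]
  have hmem : ∀ v, v ∈ Z ↔ v = a ∨ v ∈ b :: q ++ p := by
    intro v
    simp only [hpq, List.mem_append, List.mem_cons]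
    constructor
    · rintro (h | h | h | h) <;> simp [h]
    · rintro (h | (h | h) | h) <;> simp [h]
  subst hpq
  have haL : a ∉ b :: q ++ p := by
    have := hndZ.perm (l' := a :: (b :: q ++ p)) (List.perm_append_comm.trans (by simp))
    exact (List.nodup_cons.1 this).1
  rw [List.isChain_append] at hchZ
  obtain ⟨hch1, hch2, hch3⟩ := hchZ
  rw [List.isChain_cons_cons] at hch2
  -- The cycle without `a` is a path starting at `b`, joined across the closing edge between `z` and
  -- `h`; along it the remaining vertices are coloured towards `b`.
  have hchL : (b :: q ++ p).IsChain fun a b => A a b ∨ A b a := by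
    rw [List.isChain_append]
    refine ⟨hch2.2, hch1, fun x hx y hy => ?_⟩
    have hxz : x = z := by
      rw [List.getLast?_append, List.getLast?_cons_cons, Option.mem_def.1 hx] at hZlast
      simpa using hZlast
    have hyh : y = h := by
      rw [List.head?_append, Option.mem_def.1 hy] at hZhead
      simpa using hZhead
    rw [hxz, hyh]
    exact hz.symm
  have haZ : a ∈ p ++ a :: b :: q := by simp
  have hbZ : b ∈ p ++ a :: b :: q := by simp
  have hab : A a b ∧ A b a := by
    have h1 := hdig a (List.mem_append_left _ haZ) b (List.mem_append_left _ hbZ)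
    have h2 := hdig b (List.mem_append_left _ hbZ) a (List.mem_append_left _ haZ)
    exact hch2.1.elim (fun h => ⟨h, h1 h⟩) fun h => ⟨h2 h, h⟩
  obtain ⟨φ₀, hφ₀⟩ := hC.exists_isHole hk b
  refine hC.no_fork hk (S := {v | v ∉ p ++ a :: b :: q}) (φ := φ₀) hab.1 hab.2 hbu hu
    (fun h => h haZ) (fun h => h hbZ) hφ₀.choice
    (hφ₀.acyclic.mono (fun v hv => ?_) fun _ _ _ _ h => h) (fun w hw hA => ha ⟨w, hw, hA⟩) ?_
  · rintro rfl
    exact hv hbZ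
  · intro B hB hB'
    obtain ⟨c, hc⟩ := hB
    have hcL : ∀ c ∈ B, c ∈ b :: q ++ p := fun c hc =>
      ((hmem c).1 (not_not.1 (hB' c hc).1)).resolve_left (hB' c hc).2.1
    obtain ⟨x, hx, y, hy, hxB, hyB, hA⟩ := exists_boundary_of_isChain (B := B) hchL
      ⟨c, hcL c hc, hc⟩ ⟨b, by simp, fun h => (hB' b h).2.2 rfl⟩
    refine ⟨x, hxB, y, hyB, fun h => h ((hmem y).2 (.inr hy)), ?_, hA⟩
    rintro rfl
    exact haL hy

end ArcCover
end Digraph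

/-! ### Critical digraphs by degree. -/

namespace Digraph
open Relation Set
variable {V W : Type u}

/-- A path in `K` can be extended at its head until the neighbours in `K` of the head lie on it. -/
theorem exists_maximal_path [Finite V] {R : V → V → Prop} {K : Set V} {l₀ : List V}
    (h₀ : l₀ ≠ []) (hnd : l₀.Nodup) (hch : l₀.IsChain fun a b => R a b ∨ R b a)
    (hK : ∀ x ∈ l₀, x ∈ K) : ∃ l' h t, l' ++ l₀ = h :: t ∧ (h :: t).Nodup ∧
      (h :: t).IsChain (fun a b => R a b ∨ R b a) ∧ (∀ x ∈ h :: t, x ∈ K) ∧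
      ∀ w ∈ K, R h w ∨ R w h → w ∈ h :: t := by
  obtain ⟨l, ⟨h1, h2, h3, l', h4⟩, hmax⟩ := exists_maximal_list
    (Q := fun l => l.Nodup ∧ l.IsChain (fun a b => R a b ∨ R b a) ∧ (∀ x ∈ l, x ∈ K) ∧
      ∃ l', l' ++ l₀ = l) (fun l h => h.1) ⟨hnd, hch, hK, [], rfl⟩
  cases l with
  | nil => simp_all
  | cons h t =>
    refine ⟨l', h, t, h4, h1, h2, h3, fun w hw hR => ?_⟩
    by_contra hwl
    refine hmax w ⟨List.nodup_cons.2 ⟨hwl, h1⟩, List.isChain_cons_cons.2 ⟨hR.symm, h2⟩, ?_,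
      w :: l', by rw [List.cons_append, h4]⟩
    intro x hx
    rcases List.mem_cons.1 hx with rfl | hx
    · exact hw
    · exact h3 x hx

namespace ArcCover
variable {A : V → V → Prop} {C : ArcCover A W} {φ ψ : V → W} {k : ℕ}
variable [Finite V] [Finite W]

theorem IsCritical.outDeg_eq (hC : C.IsCritical k) (hk : 0 < k) (v : V) :
    {w | A v w}.ncard = k :=
  let ⟨_, h⟩ := hC.exists_isHole hk v
  h.outDeg_eq hC

/-- An arc without opposite gives a long hole `v` with bidirected reach. Since k ≥ 2, `v` has an
out-neighbour `w` off the cycle; a maximal path in the reach ending in `w`, `v` has a head other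
than `v`, whose neighbours all stay in the reach. The Hamiltonian cycle obtained from it would
contain `s`, which is not in the reach. -/
theorem IsCritical.symm_of_two_le (hC : C.IsCritical k) (hk : 2 ≤ k) {a b : V} (hab : A a b) :
    A b a := by
  by_contra hba
  obtain ⟨φ, v, hv, hK⟩ := hC.exists_bidirected_reach (by omega) ⟨a, b, hab, hba⟩
  have hv' := hv
  obtain ⟨h, s, t, hs, ht, hst⟩ := hv'
  have hdeg := h.outDeg_eq hC
  obtain ⟨w, hw, hws⟩ := exists_ne_of_one_lt_ncard (show 1 < {w | A v w}.ncard by omega) s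
  have hvw : v ≠ w := by
    rintro rfl
    exact C.irrefl _ hw
  have hworb : w ∉ C.orbit φ v := fun h1 =>
    hws (h.out_unique hC (h.F_of_adj hC .refl h1.1 hw) hs)
  have hdisj : ∀ x ∈ reach A (C.orbit φ v) v, x ∉ C.orbit φ v := by
    intro x hx
    rcases ReflTransGen.cases_tail hx with rfl | ⟨_, _, h1⟩
    · exact fun h => h.2 rfl
    · exact h1.2
  have hvK : v ∈ reach A (C.orbit φ v) v := ReflTransGen.refl
  have hwK : w ∈ reach A (C.orbit φ v) v := ReflTransGen.single ⟨.inl hw, hworb⟩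
  obtain ⟨l', h', t', heq, hnd, hch, hlK, hmax⟩ := exists_maximal_path (R := A)
    (K := reach A (C.orbit φ v) v) (l₀ := [w, v]) (by simp) (by simpa using hvw.symm)
    (by simpa using Or.inr hw) (by simp [hvK, hwK])
  have hh : h' ≠ v := by
    rintro rfl
    rw [← heq] at hnd
    cases l' with
    | nil => simp at heq; exact hvw heq.1.symm
    | cons x l' =>
      simp only [List.cons_append, List.cons.injEq] at heq
      obtain ⟨rfl, -⟩ := heq
      simp at hnd
  obtain ⟨t₁, z, t₂, rfl, -, hall⟩ := hC.exists_hamiltonian (by omega) hnd hch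
    (fun x hx => hmax x (hv.mem_reach_of_adj hC (hlK _ (by simp)) hh hx) hx)
    (fun a ha b hb => hK a (hlK a ha) b (hlK b hb))
  have hsl : s ∈ h' :: (t₁ ++ z :: t₂) := by
    have := hall s
    simp only [List.mem_cons, List.mem_append, List.not_mem_nil, or_false] at this ⊢
    rcases this with h | h | h <;> simp [h]
  exact hdisj s (hlK s hsl) ⟨.single hs, (h.choice.ne hs).symm⟩

theorem IsCritical.complete_of_three_le (hC : C.IsCritical k) (hk : 3 ≤ k) {x y : V}
    (hxy : x ≠ y) : A x y := by
  have hsymm : ∀ {a b}, A a b → A b a := fun h => hC.symm_of_two_le (by omega) h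
  by_contra hA
  -- An arc leaving the closed neighbourhood of `x` yields an induced path `x`, `v₂`, `v₃`.
  obtain ⟨v₂, h2, v₃, h3, h23⟩ := hC.connected {v | v = x ∨ A x v} ⟨x, .inl rfl⟩
    ⟨y, fun h => h.elim (fun h => hxy h.symm) hA⟩
  have h23 : A v₂ v₃ := h23.elim id hsymm
  simp only [mem_ofPred_eq, not_or] at h2 h3
  have h2x : v₂ ≠ x := by
    rintro rfl
    exact h3.2 h23
  have h12 : A x v₂ := h2.resolve_left h2x
  have hne23 : v₂ ≠ v₃ := by
    rintro rfl
    exact C.irrefl _ h23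
  obtain ⟨l', h', t', heq, hnd, hch, -, hmax⟩ := exists_maximal_path (R := A) (K := univ)
    (l₀ := [v₃, v₂, x]) (by simp) (by simp [hne23.symm, h3.1, h2x])
    (by simp [h23, h12]) (by simp)
  obtain ⟨t₁, z, t₂, rfl, -, hall⟩ := hC.exists_hamiltonian (by omega) hnd hch
    (fun w hw => hmax w trivial hw) (fun a _ b _ => hsymm)
  have hall' : ∀ v, v ∈ l' ++ [v₃, v₂, x] := by
    intro v
    have := hall v
    rw [heq]
    simp only [List.mem_cons, List.mem_append, List.not_mem_nil, or_false] at this ⊢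
    rcases this with h | h | h <;> simp [h]
  rw [← heq] at hnd hch
  have hl' : ∀ v, v ∈ l' ↔ v ≠ x ∧ v ≠ v₂ ∧ v ≠ v₃ := by
    intro v
    constructor
    · intro hv
      have := (List.nodup_append.1 hnd).2.2 v hv
      exact ⟨this x (by simp), this v₂ (by simp), this v₃ (by simp)⟩
    · rintro ⟨h1, h2, h3⟩
      simpa [h1, h2, h3] using hall' v
  have hdeg := hC.outDeg_eq (by omega) v₂
  -- k ≥ 3 gives `v₂` a neighbour on the remaining path `l'`, which can therefore be coloured
  -- greedily towards `v₂`. The fork is `x`, `v₂`, `v₃` with only `v₃` precoloured.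
  obtain ⟨w, hw, hwx⟩ : ∃ w, A v₂ w ∧ w ∉ ({x, v₃} : Set V) := by
    by_contra! hcon
    have h5 : {w | A v₂ w}.ncard ≤ ({x, v₃} : Set V).ncard := ncard_le_ncard hcon (toFinite _)
    rw [ncard_pair (Ne.symm h3.1)] at h5
    omega
  have hwv : w ≠ v₂ := by
    rintro rfl
    exact C.irrefl _ hw
  simp only [mem_insert_iff, mem_singleton_iff, not_or] at hwx
  obtain ⟨φ₀, hφ₀⟩ := hC.exists_isHole (by omega) v₂
  refine hC.no_fork (by omega) (S := {v₃}) (φ := φ₀) h12 (hsymm h12) (.inl h23) rfl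
    (fun h => h3.1 h.symm) hne23 hφ₀.choice
    (hφ₀.acyclic.mono (by simpa using hne23) fun _ _ _ _ h => h) ?_ ?_
  · rintro _ rfl
    exact fun h => h.elim h3.2 fun h => h3.2 (hsymm h)
  · intro B ⟨c, hc⟩ hB
    have hBl : ∀ c ∈ B, c ∈ l' := fun c hc =>
      (hl' c).2 ⟨(hB c hc).2.1, (hB c hc).2.2, (hB c hc).1⟩
    by_cases hlB : ∃ d ∈ l', d ∉ B
    · obtain ⟨a, ha, b, hb, haB, hbB, hab⟩ := exists_boundary_of_isChain
        hch.left_of_append ⟨c, hBl c hc, hc⟩ hlB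
      have := (hl' b).1 hb
      exact ⟨a, haB, b, hbB, this.2.2, this.1, hab⟩
    · push Not at hlB
      refine ⟨w, hlB w ((hl' w).2 ⟨hwx.1, hwv, hwx.2⟩), v₂, fun h => (hB v₂ h).2.2 rfl, hne23,
        h2x, .inr hw⟩

theorem IsCritical.exists_cycle_of_two (hC : C.IsCritical 2) :
    ∃ l : List V, ∃ h : l ≠ [], l.Nodup ∧ (∀ v, v ∈ l) ∧ l.IsChain A ∧
      A (l.getLast h) (l.head h) ∧ 3 ≤ l.length := by
  have hsymm : ∀ {a b}, A a b → A b a := fun h => hC.symm_of_two_le le_rfl h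
  obtain ⟨v⟩ : Nonempty V := by
    by_contra hV
    rw [not_nonempty_iff] at hV
    refine hC.not_acyclic (fun v => hV.elim v) (fun v => hV.elim v) fun v => hV.elim v
  obtain ⟨l', h', t', heq, hnd, hch, -, hmax⟩ := exists_maximal_path (R := A) (K := univ)
    (l₀ := [v]) (by simp) (by simp) (by simp) (by simp)
  obtain ⟨t₁, z, t₂, rfl, hz, hall⟩ := hC.exists_hamiltonian (by omega) hnd hch
    (fun w hw => hmax w trivial hw) (fun a _ b _ => hsymm)
  have hsplit : h' :: (t₁ ++ z :: t₂) = (h' :: (t₁ ++ [z])) ++ t₂ := by simp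
  rw [hsplit] at hnd hch
  refine ⟨h' :: (t₁ ++ [z]), by simp, hnd.of_append_left, hall,
    hch.left_of_append.imp fun a b h => h.elim id hsymm, ?_, ?_⟩
  · rw [List.getLast_congr _ (by simp) (List.cons_append.symm), List.getLast_append_singleton]
    exact hz.elim hsymm id
  -- A closing edge equal to the only path edge would leave `h'` a single neighbour instead of two.
  · have hdeg := hC.outDeg_eq (by omega) h'
    by_contra hlt
    have ht : t₁ = [] := by
      cases t₁ with
      | nil => rfl
      | cons => simp at hlt
    subst ht
    have h1 : {w | A h' w} ⊆ {z} := by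
      intro w hw
      have := hall w
      simp only [List.nil_append, List.mem_cons, List.not_mem_nil, or_false] at this
      refine this.resolve_left ?_
      rintro rfl
      exact C.irrefl _ hw
    have h2 := ncard_le_ncard h1 (toFinite _)
    rw [ncard_singleton] at h2
    omega

/-- With degree one, the only arc out of a hole is the chosen one, and dually for arcs into it. The
closed walk is thus closed under adjacency and, by connectedness, is everything. -/
theorem IsCritical.exists_perm_of_one (hC : C.IsCritical 1) : ∃ σ : Equiv.Perm V,
    (∀ a b, A a b ↔ b = σ a) ∧ ∃ v, ∀ w, ReflTransGen A v w := by
  obtain ⟨v⟩ : Nonempty V := by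
    by_contra hV
    rw [not_nonempty_iff] at hV
    refine hC.not_acyclic (fun v => hV.elim v) (fun v => hV.elim v) fun v => hV.elim v
  obtain ⟨φ, h⟩ := hC.exists_isHole one_pos v
  have hout : ∀ {A : V → V → Prop} {C : ArcCover A W}, C.IsCritical 1 → C.IsHole φ v →
      ∀ u w, C.IsHole φ u → A u w → C.F φ u w := by
    intro A C hC h u w hu huw
    obtain ⟨s, hs⟩ := hu.exists_out hC
    have h1 := hu.outDeg_eq hC
    obtain ⟨r, hr⟩ := ncard_eq_one.1 h1
    have h2 : s ∈ {w | A u w} := hu.choice.adj hs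
    have h3 : w ∈ {w | A u w} := huw
    rw [hr] at h2 h3
    rw [h3, ← h2]
    exact hs
  have hall : ∀ w, ReflTransGen (C.F φ) v w := by
    by_contra! hcon
    obtain ⟨a, ha, b, hb, hab⟩ := hC.connected {w | ReflTransGen (C.F φ) v w} ⟨v, .refl⟩ hcon
    have hole := h.of_reflTransGen hC ha
    rcases hab with hab | hab
    · exact hb (ReflTransGen.tail ha (hout hC h a b hole hab))
    · exact hb (h.reflTransGen_pred hC ha (hout hC.reverse h.reverse a b hole.reverse hab))
  have hA : ∀ a b, A a b ↔ C.F φ a b := fun a b =>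
    ⟨fun hab => h.F_of_adj hC (hall a) (hall b) hab, h.choice.adj⟩
  have hole : ∀ a, C.IsHole φ a := fun a => h.of_reflTransGen hC (hall a)
  choose f hf using fun a => (hole a).exists_out hC
  have hinj : Function.Injective f := fun a b hab =>
    (hole (f a)).in_unique hC (hf a) (hab ▸ hf b)
  refine ⟨Equiv.ofBijective f hinj.bijective_of_finite, fun a b => ?_, v, fun w =>
    ReflTransGen.mono (fun _ _ h1 => h.choice.adj h1) _ _ (hall w)⟩
  rw [hA]
  constructor
  · exact fun h1 => (hole a).out_unique hC h1 (hf a)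
  · rintro rfl
    exact hf a

end ArcCover
end Digraph

/-! ### From covers to critical covers, and recognition of the extremal digraphs. -/

namespace Digraph
open Relation Set
variable {V W : Type u} {D : Digraph V}

theorem DPCover.eq_of_mem (C : D.DPCover W) {a b : V} {z : W} (ha : z ∈ C.X a)
    (hb : z ∈ C.X b) : a = b := by
  by_contra hab
  exact disjoint_left.1 (C.disjoint a b hab) ha hb

/-- A cover in the sense of `DPCover`, regarded as an `ArcCover`. -/
def DPCover.toArcCover (C : D.DPCover W) (loopless : ∀ v, ¬ D.Adj v v) : ArcCover D.Adj W where
  X := C.X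
  H := C.H.Adj
  irrefl := loopless
  proj := fun {u v x y} hx hy h => by
    obtain ⟨u', v', hA, hx', hy'⟩ := C.arcs x y h
    rwa [C.eq_of_mem hx hx', C.eq_of_mem hy hy']
  out_unique := fun {u v x y y'} hx hy hy' h h' => by
    obtain ⟨u', v', hA, hx', hy''⟩ := C.arcs x y h
    obtain rfl := C.eq_of_mem hx hx'
    obtain rfl := C.eq_of_mem hy hy''
    by_contra hne
    exact disjoint_left.1 (C.matching u v hA (x, y) ⟨hx, hy, h⟩ (x, y') ⟨hx, hy', h'⟩
      (by simpa using hne)) (.inl rfl) (.inl rfl)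
  in_unique := fun {u v x x' y} hx hx' hy h h' => by
    obtain ⟨u', v', hA, hx'', hy'⟩ := C.arcs x y h
    obtain rfl := C.eq_of_mem hx hx''
    obtain rfl := C.eq_of_mem hy hy'
    by_contra hne
    exact disjoint_left.1 (C.matching u v hA (x, y) ⟨hx, hy, h⟩ (x', y) ⟨hx', hy, h'⟩
      (by simpa using hne)) (.inr rfl) (.inr rfl)

theorem DPCover.colorable_of_acyclicOn (C : D.DPCover W) (loopless : ∀ v, ¬ D.Adj v v)
    {φ : V → W} (hφ : (C.toArcCover loopless).IsChoice φ)
    (h : AcyclicOn ((C.toArcCover loopless).F φ) univ) : C.Colorable := by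
  refine ⟨range φ, fun v => ⟨φ v, ⟨mem_range_self v, hφ v⟩, ?_⟩, ?_⟩
  · rintro _ ⟨⟨u, rfl⟩, hu⟩
    rw [C.eq_of_mem (hφ u) hu]
  · rintro ⟨p, hp, c, -, hc, hadj⟩
    choose g hg using hc
    have key : ∀ n : ℕ, TransGen (fun a b => a ∈ univ ∧ b ∈ univ ∧
        (C.toArcCover loopless).F φ a b) (g 0) (g ((n + 1 : ℕ) : ZMod p)) := by
      have hstep : ∀ i, (C.toArcCover loopless).F φ (g i) (g (i + 1)) := fun i => by
        change C.H.Adj (φ (g i)) (φ (g (i + 1)))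
        rw [hg, hg]
        exact hadj i
      intro n
      induction n with
      | zero => exact .single ⟨trivial, trivial, by simpa using hstep 0⟩
      | succ n ih => exact ih.tail ⟨trivial, trivial, by simpa using hstep ((n + 1 : ℕ) : ZMod p)⟩
    have h1 := key (p - 1)
    rw [Nat.sub_add_cancel (by omega), ZMod.natCast_self] at h1
    exact h _ h1

section Degrees

variable [Fintype V]

theorem outDeg_le_maxOutDeg (v : V) : D.outDeg v ≤ D.maxOutDeg :=
  Finset.le_sup (f := D.outDeg) (Finset.mem_univ v)

theorem inDeg_le_maxInDeg (v : V) : D.inDeg v ≤ D.maxInDeg :=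
  Finset.le_sup (f := D.inDeg) (Finset.mem_univ v)

theorem max_maxDeg_le {k : ℕ} (h₁ : ∀ v, D.outDeg v ≤ k) (h₂ : ∀ v, D.inDeg v ≤ k) :
    max D.maxOutDeg D.maxInDeg ≤ k :=
  max_le (Finset.sup_le fun v _ => h₁ v) (Finset.sup_le fun v _ => h₂ v)

end Degrees

theorem DPColorable.mono {k l : ℕ} (hkl : k ≤ l) (h : D.DPColorable k) : D.DPColorable l :=
  fun W _ C hC => h W C fun v => hkl.trans (hC v)

theorem dpColorable_succ [Fintype V] (loopless : ∀ v, ¬ D.Adj v v) :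
    D.DPColorable (max D.maxOutDeg D.maxInDeg + 1) := by
  intro W _ C hC
  obtain ⟨φ, hφ, h⟩ := ArcCover.exists_acyclic_of_outDeg_lt (C := C.toArcCover loopless)
    fun v => (Nat.lt_succ_of_le ((outDeg_le_maxOutDeg v).trans (le_max_left _ _))).trans_le (hC v)
  exact C.colorable_of_acyclicOn loopless hφ h

theorem exists_adj_of_connected (connected : D.toSimpleGraphInclusive.Connected) {B : Set V}
    (h : B.Nonempty) (h' : Bᶜ.Nonempty) : ∃ a ∈ B, ∃ b ∉ B, D.Adj a b ∨ D.Adj b a := by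
  obtain ⟨x, hx⟩ := h
  obtain ⟨y, hy⟩ := h'
  obtain ⟨p⟩ := connected.preconnected x y
  obtain ⟨d, -, h1, h2⟩ := p.exists_boundary_dart B hx hy
  exact ⟨d.fst, h1, d.snd, h2, d.adj.2⟩

theorem isDirectedCycle_of_perm [Finite V] (loopless : ∀ v, ¬ D.Adj v v) {σ : Equiv.Perm V}
    (hσ : ∀ a b, D.Adj a b ↔ b = σ a) {v : V} (hv : ∀ w, ReflTransGen D.Adj v w) :
    D.IsDirectedCycle := by
  have horb : ∀ w, w ∈ MulAction.orbit (Subgroup.zpowers σ) v := by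
    intro w
    induction hv w with
    | refl => exact MulAction.mem_orbit_self v
    | @tail b c _ h ih =>
      obtain ⟨g, rfl⟩ := ih
      rw [(hσ _ _).1 h]
      exact ⟨⟨σ, Subgroup.mem_zpowers σ⟩ * g, mul_smul (⟨σ, Subgroup.mem_zpowers σ⟩ :
        Subgroup.zpowers σ) g v⟩
  set p := Function.minimalPeriod (σ • ·) v with hp
  let e : ZMod p ≃ V := (MulAction.orbitZPowersEquiv σ v).symm.trans
    ((Equiv.setCongr (eq_univ_of_forall horb)).trans (Equiv.Set.univ V))
  have he : ∀ n : ℤ, e n = (σ ^ n) v := by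
    intro n
    have := MulAction.orbitZPowersEquiv_symm_apply' σ v n
    simp only [e, Equiv.trans_apply, Equiv.setCongr_apply, Equiv.Set.univ_apply]
    rw [this]
    rfl
  have hsucc : ∀ i, σ (e i) = e (i + 1) := by
    intro i
    obtain ⟨n, rfl⟩ := ZMod.intCast_surjective i
    have h1 := he (n + 1)
    push_cast at h1
    rw [h1, he, add_comm, zpow_add, zpow_one]
    rfl
  have hfin : Finite (ZMod p) := Finite.of_equiv V e.symm
  -- `ZMod 0` is infinite, and period one would be a loop.
  have hp2 : 2 ≤ p := by
    by_contra hlt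
    have hp' : p = 0 ∨ p = 1 := by omega
    rcases hp' with h0 | h1
    · rw [h0] at hfin
      exact not_finite_iff_infinite.2 (inferInstanceAs (Infinite ℤ)) hfin
    · have : Subsingleton (ZMod p) := by rw [h1]; exact inferInstanceAs (Subsingleton (Fin 1))
      refine loopless (e 0) ((hσ _ _).2 ?_)
      rw [hsucc]
      exact congrArg e (Subsingleton.elim _ _)
  refine ⟨p, hp2, e, fun i j => ?_⟩
  rw [hσ, hsucc, e.apply_eq_iff_eq]

theorem isBidirectedCycle_of_list (loopless : ∀ v, ¬ D.Adj v v)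
    (hsymm : ∀ a b, D.Adj a b → D.Adj b a) (hdeg : ∀ v, {w | D.Adj v w}.ncard = 2) {l : List V}
    (hne : l ≠ []) (hnd : l.Nodup) (hall : ∀ v, v ∈ l) (hch : l.IsChain D.Adj)
    (hclose : D.Adj (l.getLast hne) (l.head hne)) (hlen : 3 ≤ l.length) :
    D.IsBidirectedCycle := by
  classical
  obtain ⟨n, hn⟩ : ∃ n, l.length = n + 3 := ⟨l.length - 3, by omega⟩
  let e : Fin (n + 3) ≃ V := (finCongr hn.symm).trans (hnd.getEquivOfForallMemList l hall)
  have he : ∀ i : Fin (n + 3), e i = l[i.val] := fun i => rfl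
  have hsucc : ∀ i, D.Adj (e i) (e (i + 1)) := by
    intro i
    by_cases hi : i = Fin.last _
    · subst hi
      rw [Fin.last_add_one, he, he]
      convert hclose using 1
      · rw [List.getLast_eq_getElem]
        congr 1
        simp [hn]
      · rw [List.head_eq_getElem]
        rfl
    · have hlt : i.val < n + 2 := Fin.lt_last_iff_ne_last.2 hi
      have hi' : (i + 1).val = i.val + 1 := Fin.val_add_one_of_lt (Fin.lt_last_iff_ne_last.2 hi)
      have h1 := List.isChain_iff_getElem.1 hch i.val (by omega)
      rw [he, he]
      convert h1 using 1
      simp only [hi']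
  have hpred : ∀ i, D.Adj (e i) (e (i - 1)) := fun i => by
    have := hsymm _ _ (hsucc (i - 1))
    rwa [sub_add_cancel] at this
  -- Length at least three separates successor from predecessor, so together they exhaust the two
  -- out-neighbours.
  have hne' : ∀ i : Fin (n + 3), i + 1 ≠ i - 1 := by
    intro i h
    have h1 : (1 : Fin (n + 3)) + 1 = 0 := by
      rw [sub_eq_add_neg] at h
      have := add_left_cancel h
      nth_rewrite 1 [this]
      simp
    have h2 := congrArg Fin.val h1
    simp [Fin.val_add, Nat.mod_eq_of_lt] at h2
  have hadj : ∀ i j, D.Adj (e i) (e j) ↔ j = i + 1 ∨ j = i - 1 := by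
    intro i j
    have h1 : ({e (i + 1), e (i - 1)} : Set V) = {w | D.Adj (e i) w} := by
      have hfin : {w | D.Adj (e i) w}.Finite := finite_of_ncard_ne_zero (by rw [hdeg]; decide)
      refine eq_of_subset_of_ncard_le ?_ ?_ hfin
      · rintro _ (rfl | rfl)
        · exact hsucc i
        · exact hpred i
      · rw [hdeg, ncard_pair (fun h => hne' i (e.injective h))]
    have h2 : D.Adj (e i) (e j) ↔ e j ∈ ({e (i + 1), e (i - 1)} : Set V) := by rw [h1]; rfl
    rw [h2, mem_insert_iff, mem_singleton_iff, e.apply_eq_iff_eq, e.apply_eq_iff_eq]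
  let G : SimpleGraph V := ⟨D.Adj, ⟨fun a b h => hsymm a b h⟩, ⟨loopless⟩⟩
  refine ⟨G, rfl, n + 3, by omega, ⟨⟨e.symm, ?_⟩⟩⟩
  intro a b
  obtain ⟨i, rfl⟩ := e.surjective a
  obtain ⟨j, rfl⟩ := e.surjective b
  rw [e.symm_apply_apply, e.symm_apply_apply, SimpleGraph.cycleGraph_adj]
  refine Iff.trans ?_ (hadj i j).symm
  constructor
  · rintro (h | h)
    · exact .inr (by rw [← h]; abel)
    · exact .inl (by rw [← h]; abel)
  · rintro (h | h)
    · exact .inr (by rw [h]; abel)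
    · exact .inl (by rw [h]; abel)

/-- Brooks' theorem for DP-colorings of digraphs, the extremal case. -/
theorem classification_of_not_dpColorable [Fintype V] (loopless : ∀ v, ¬ D.Adj v v)
    (connected : D.toSimpleGraphInclusive.Connected)
    (h : ¬ D.DPColorable (max D.maxOutDeg D.maxInDeg)) :
    D.IsDirectedCycle ∨ D.IsBidirectedCycle ∨ D.IsBidirectedComplete := by
  generalize hk : max D.maxOutDeg D.maxInDeg = k at h
  simp only [DPColorable, DPColorableFun, not_forall] at h
  obtain ⟨W, _, C, hcard, hcol⟩ := h
  have hC : (C.toArcCover loopless).IsCritical k :=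
    { out_le := fun v => hk ▸ (outDeg_le_maxOutDeg v).trans (le_max_left _ _)
      in_le := fun v => hk ▸ (inDeg_le_maxInDeg v).trans (le_max_right _ _)
      le_card := hcard
      not_acyclic := fun φ hφ h => hcol (C.colorable_of_acyclicOn loopless hφ h)
      connected := fun B h h' => exists_adj_of_connected connected h h' }
  have hcomplete : (∀ x y, x ≠ y → D.Adj x y) → D.IsBidirectedComplete := by
    intro hall
    refine Digraph.ext (funext fun x => funext fun y => propext ⟨?_, hall x y⟩)
    rintro hxy rfl
    exact loopless _ hxy
  obtain rfl | rfl | rfl | hk3 : k = 0 ∨ k = 1 ∨ k = 2 ∨ 3 ≤ k := by omega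
  -- Degree zero: a connected digraph without arcs is a single vertex, which counts as complete.
  · refine .inr (.inr (hcomplete fun x y hxy => ?_))
    obtain ⟨a, -, b, -, hab⟩ := hC.connected {x} ⟨x, rfl⟩ ⟨y, fun h => hxy h.symm⟩
    have hno : ∀ a b, ¬ D.Adj a b := fun a b hab => by
      have h1 := hC.out_le a
      rw [Nat.le_zero, ncard_eq_zero (toFinite _)] at h1
      exact notMem_empty b (h1 ▸ hab)
    exact (hab.elim (hno a b) (hno b a)).elim
  · obtain ⟨σ, hσ, v, hv⟩ := hC.exists_perm_of_one
    exact .inl (isDirectedCycle_of_perm loopless hσ hv)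
  · obtain ⟨l, hne, hnd, hall, hch, hclose, hlen⟩ := hC.exists_cycle_of_two
    exact .inr (.inl (isBidirectedCycle_of_list loopless
      (fun a b h => hC.symm_of_two_le le_rfl h) (hC.outDeg_eq two_pos) hne hnd hall hch hclose
      hlen))
  · exact .inr (.inr (hcomplete fun x y hxy => hC.complete_of_three_le hk3 hxy))

/-! ### Covers showing that the extremal digraphs attain the bound. -/

/-- The cover with color set `{v} × ι` at each vertex `v`, the arcs over `uv` being described by the
partial injection `r u v`. -/
def prodCover (loopless : ∀ v, ¬ D.Adj v v) {ι : Type} (r : V → V → ι → ι → Prop)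
    (h₁ : ∀ u v s t t', r u v s t → r u v s t' → t = t')
    (h₂ : ∀ u v s s' t, r u v s t → r u v s' t → s = s') : D.DPCover (V × ι) where
  X v := {x | x.1 = v}
  H := ⟨fun x y => D.Adj x.1 y.1 ∧ r x.1 y.1 x.2 y.2⟩
  disjoint u v huv := disjoint_left.2 fun x hx hx' => huv (hx.symm.trans hx')
  iUnion_eq := eq_univ_of_forall fun x => mem_iUnion.2 ⟨x.1, rfl⟩
  indep := by
    rintro v x rfl y hy h
    have hy' : y.1 = x.1 := hy
    exact loopless x.1 (hy' ▸ h.1)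
  matching := by
    rintro u v huv ⟨⟨a, s⟩, ⟨b, t⟩⟩ ⟨ha, hb, hab, hr⟩ ⟨⟨a', s'⟩, ⟨b', t'⟩⟩ ⟨ha', hb', hab', hr'⟩ hne
    simp only [mem_ofPred_eq] at ha hb ha' hb'
    subst ha hb ha' hb'
    have hne' : a' ≠ b' := by
      rintro rfl
      exact loopless _ huv
    have hst : s ≠ s' := by
      rintro rfl
      exact hne (by rw [show t = t' from h₁ _ _ _ _ _ hr hr'])
    have htt : t ≠ t' := by
      rintro rfl
      exact hne (by rw [show s = s' from h₂ _ _ _ _ _ hr hr'])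
    simp [hne', hne'.symm, hst.symm, htt.symm]
  arcs x y h := ⟨x.1, y.1, h.1, rfl, rfl⟩

theorem not_dpColorable_of_forall_cycle [Finite V] (loopless : ∀ v, ¬ D.Adj v v) {ι : Type}
    [Finite ι] (r : V → V → ι → ι → Prop)
    (h₁ : ∀ u v s t t', r u v s t → r u v s t' → t = t')
    (h₂ : ∀ u v s s' t, r u v s t → r u v s' t → s = s')
    (h : ∀ c : V → ι, ∃ p : ℕ, 2 ≤ p ∧ ∃ e : ZMod p → V, Function.Injective e ∧
      ∀ i, D.Adj (e i) (e (i + 1)) ∧ r (e i) (e (i + 1)) (c (e i)) (c (e (i + 1)))) :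
    ¬ D.DPColorable (Nat.card ι) := by
  intro hD
  obtain ⟨T, hT, hcyc⟩ := hD (V × ι) (prodCover loopless r h₁ h₂) fun v => by
    have h3 : (prodCover loopless r h₁ h₂).X v = range (Prod.mk v) := by
      ext ⟨a, s⟩
      exact ⟨fun h => ⟨s, by rw [← show a = v from h]⟩, fun ⟨t, ht⟩ => (congrArg Prod.fst ht).symm⟩
    rw [h3, ← Nat.card_coe_set_eq, Nat.card_range_of_injective (Prod.mk_right_injective v)]
  have hc : ∀ v, ∃ s, (v, s) ∈ T := fun v => by
    obtain ⟨⟨a, s⟩, ⟨h3, h4⟩, -⟩ := hT v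
    exact ⟨s, (show a = v from h4) ▸ h3⟩
  choose c hc using hc
  obtain ⟨p, hp, e, he, hadj⟩ := h c
  exact hcyc ⟨p, hp, fun i => (e i, c (e i)), fun i j hij => he (congrArg Prod.fst hij),
    fun i => hc _, hadj⟩

theorem not_dpColorable_of_forall_digon [Finite V] (loopless : ∀ v, ¬ D.Adj v v) {ι : Type}
    [Finite ι] (r : V → V → ι → ι → Prop)
    (h₁ : ∀ u v s t t', r u v s t → r u v s t' → t = t')
    (h₂ : ∀ u v s s' t, r u v s t → r u v s' t → s = s')
    (h : ∀ c : V → ι, ∃ u v, (D.Adj u v ∧ r u v (c u) (c v)) ∧ D.Adj v u ∧ r v u (c v) (c u)) :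
    ¬ D.DPColorable (Nat.card ι) := by
  refine not_dpColorable_of_forall_cycle loopless r h₁ h₂ fun c => ?_
  obtain ⟨u, v, huv, hvu⟩ := h c
  have hne : u ≠ v := by
    rintro rfl
    exact loopless _ huv.1
  refine ⟨2, le_rfl, (![u, v] : Fin 2 → V), ?_, ?_⟩
  · intro i j hij
    change Fin 2 at i j
    fin_cases i <;> fin_cases j <;> first | rfl | simp_all
  · intro i
    change Fin 2 at i
    fin_cases i
    · exact huv
    · exact hvu

/-- With one colour per vertex and all arcs present, the only transversal is a copy of the cycle. -/
theorem IsDirectedCycle.not_dpColorable [Fintype V] (loopless : ∀ v, ¬ D.Adj v v)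
    (h : D.IsDirectedCycle) : ¬ D.DPColorable (max D.maxOutDeg D.maxInDeg) := by
  obtain ⟨p, hp, e, he⟩ := h
  have hle : max D.maxOutDeg D.maxInDeg ≤ Nat.card Unit := by
    rw [Nat.card_unique]
    refine max_maxDeg_le (fun v => ?_) fun v => ?_
    · refine (ncard_le_ncard (t := {e (e.symm v + 1)}) ?_ (toFinite _)).trans_eq
        (ncard_singleton _)
      intro w hw
      have := (he (e.symm v) (e.symm w)).1 (by simpa using hw)
      simp [← this]
    · refine (ncard_le_ncard (t := {e (e.symm v - 1)}) ?_ (toFinite _)).trans_eq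
        (ncard_singleton _)
      intro w hw
      have := (he (e.symm w) (e.symm v)).1 (by simpa using hw)
      simp [this]
  refine fun hD => not_dpColorable_of_forall_cycle loopless (ι := Unit) (fun _ _ _ _ => True)
    (fun _ _ _ _ _ _ _ => rfl) (fun _ _ _ _ _ _ _ => rfl) (fun c => ?_) (hD.mono hle)
  exact ⟨p, hp, e, e.injective, fun i => ⟨(he _ _).2 rfl, trivial⟩⟩

/-- Ordinary colouring with n - 1 colours: by pigeonhole two vertices share a colour and form a
digon. -/
theorem IsBidirectedComplete.not_dpColorable [Fintype V] [Nonempty V]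
    (loopless : ∀ v, ¬ D.Adj v v) (h : D.IsBidirectedComplete) :
    ¬ D.DPColorable (max D.maxOutDeg D.maxInDeg) := by
  have hadj : ∀ u v, D.Adj u v ↔ u ≠ v := fun u v => by rw [h]; rfl
  have hcount : ∀ v : V, ({v}ᶜ : Set V).ncard ≤ Nat.card (Fin (Fintype.card V - 1)) := fun v => by
    rw [ncard_compl, ncard_singleton, Nat.card_eq_fintype_card, Nat.card_eq_fintype_card,
      Fintype.card_fin]
  have hle : max D.maxOutDeg D.maxInDeg ≤ Nat.card (Fin (Fintype.card V - 1)) :=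
    max_maxDeg_le
      (fun v => (ncard_le_ncard (fun w hw => ((hadj _ _).1 hw).symm) (toFinite _)).trans (hcount v))
      (fun v => (ncard_le_ncard (fun w hw => (hadj _ _).1 hw) (toFinite _)).trans (hcount v))
  refine fun hD => not_dpColorable_of_forall_digon loopless (fun _ _ s t => s = t)
    (fun _ _ _ _ _ h h' => h.symm.trans h') (fun _ _ _ _ _ h h' => h.trans h'.symm)
    (fun c => ?_) (hD.mono hle)
  have hpos := Fintype.card_pos (α := V)
  obtain ⟨u, v, huv, hc⟩ := Fintype.exists_ne_map_eq_of_card_lt c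
    (by rw [Fintype.card_fin]; omega)
  exact ⟨u, v, ⟨(hadj _ _).2 huv, hc⟩, (hadj _ _).2 huv.symm, hc.symm⟩

/-- Two colours, with one twisted edge: digons join unequal colours on all edges but one, and equal
colours on that one. Avoiding digons forces a constant colour along the path, and then the twisted
edge is a digon, whatever the parity of the length. -/
theorem IsBidirectedCycle.not_dpColorable [Fintype V] (loopless : ∀ v, ¬ D.Adj v v)
    (h : D.IsBidirectedCycle) : ¬ D.DPColorable (max D.maxOutDeg D.maxInDeg) := by
  obtain ⟨G, rfl, p, hp, ⟨f⟩⟩ := h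
  obtain ⟨n, rfl⟩ : ∃ n, p = n + 3 := ⟨p - 3, by omega⟩
  have hadj : ∀ u v, (bidirected G).Adj u v ↔ f u - f v = 1 ∨ f v - f u = 1 := fun u v =>
    f.map_adj_iff.symm.trans SimpleGraph.cycleGraph_adj
  have hle : max (bidirected G).maxOutDeg (bidirected G).maxInDeg ≤ Nat.card Bool := by
    have hcount : ∀ v : V, {w | f v - f w = 1 ∨ f w - f v = 1}.ncard ≤ Nat.card Bool := by
      intro v
      rw [Nat.card_eq_fintype_card, Fintype.card_bool]
      have hsub : {w | f v - f w = 1 ∨ f w - f v = 1} ⊆ {f.symm (f v - 1), f.symm (f v + 1)} := by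
        rintro w (hw | hw)
        · left
          rw [← hw, sub_sub_cancel, RelIso.symm_apply_apply]
        · right
          rw [mem_singleton_iff, ← hw, add_sub_cancel, RelIso.symm_apply_apply]
      exact (ncard_le_ncard hsub (toFinite _)).trans (ncard_insert_le _ _ |>.trans
        (by rw [ncard_singleton]))
    refine max_maxDeg_le (fun v => le_trans ?_ (hcount v)) (fun v => le_trans ?_ (hcount v))
    · exact ncard_le_ncard (fun w hw => (hadj _ _).1 hw) (toFinite _)
    · exact ncard_le_ncard (fun w hw => ((hadj _ _).1 hw).symm) (toFinite _)
  let special : V → V → Prop := fun u v =>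
    (f u = 0 ∧ f v = Fin.last (n + 2)) ∨ (f u = Fin.last (n + 2) ∧ f v = 0)
  have hsp : ∀ u v, special u v ↔ special v u := fun u v => by
    simp only [special]
    tauto
  refine fun hD => not_dpColorable_of_forall_digon loopless
    (fun u v (s t : Bool) => s = t ↔ special u v) ?_ ?_ (fun c => ?_) (hD.mono hle)
  · intro u v s t t' h h'
    by_cases hs : special u v <;> revert h h' <;> cases s <;> cases t <;> cases t' <;> simp [hs]
  · intro u v s s' t h h'
    by_cases hs : special u v <;> revert h h' <;> cases s <;> cases t <;> cases s' <;> simp [hs]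
  · by_contra! hcon
    have hno : ∀ u v, (bidirected G).Adj u v → ¬ (c u = c v ↔ special u v) := by
      intro u v huv hr
      have hvu : (bidirected G).Adj v u := (hadj _ _).2 ((hadj _ _).1 huv).symm
      have := hcon u v ⟨huv, hr⟩ hvu
      rw [eq_comm, hr, hsp] at this
      tauto
    have hconst : ∀ m (hm : m < n + 3), c (f.symm ⟨m, hm⟩) = c (f.symm 0) := by
      intro m
      induction m with
      | zero => exact fun _ => rfl
      | succ m ih =>
        intro hm
        rw [← ih (by omega)]
        by_contra hne
        refine hno (f.symm ⟨m + 1, hm⟩) (f.symm ⟨m, by omega⟩) ?_ ?_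
        · rw [hadj, RelIso.apply_symm_apply, RelIso.apply_symm_apply]
          left
          rw [sub_eq_iff_eq_add, Fin.ext_iff, Fin.val_add]
          simp [Nat.mod_eq_of_lt hm, add_comm]
        · refine iff_of_false hne ?_
          simp only [special, RelIso.apply_symm_apply, Fin.ext_iff, Fin.val_last, Fin.val_zero]
          omega
    refine hno (f.symm 0) (f.symm (Fin.last _)) ?_ (iff_of_true (hconst _ _).symm ?_)
    · rw [hadj, RelIso.apply_symm_apply, RelIso.apply_symm_apply]
      left
      rw [sub_eq_iff_eq_add]
      exact (Fin.last_add_one _).symm.trans (add_comm _ _)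
    · exact .inl ⟨RelIso.apply_symm_apply _ _, RelIso.apply_symm_apply _ _⟩

theorem dpChromaticNumber_le {k : ℕ} (h : D.DPColorable k) : D.dpChromaticNumber ≤ k :=
  iInf₂_le k h

theorem lt_dpChromaticNumber {k : ℕ} (h : ¬ D.DPColorable k) :
    ((k + 1 : ℕ) : ℕ∞) ≤ D.dpChromaticNumber := by
  refine le_iInf₂ fun l hl => ?_
  rw [Nat.cast_le, Nat.succ_le_iff]
  by_contra hlk
  exact h (DPColorable.mono (not_lt.1 hlk) hl)

end Digraph

theorem mainTheorem3 {V : Type u} [Fintype V] (D : Digraph V)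
    (loopless : ∀ v, ¬ D.Adj v v)
    (connected : D.toSimpleGraphInclusive.Connected) :
    D.dpChromaticNumber ≤ ((max D.maxOutDeg D.maxInDeg + 1 : ℕ) : ℕ∞) ∧
    (D.dpChromaticNumber = ((max D.maxOutDeg D.maxInDeg + 1 : ℕ) : ℕ∞) ↔
      D.IsDirectedCycle ∨ D.IsBidirectedCycle ∨ D.IsBidirectedComplete) := by
  have hle := Digraph.dpChromaticNumber_le (Digraph.dpColorable_succ loopless)
  refine ⟨hle, fun heq => ?_, fun h => le_antisymm hle (Digraph.lt_dpChromaticNumber ?_)⟩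
  · refine Digraph.classification_of_not_dpColorable loopless connected fun h => ?_
    have h1 := Digraph.dpChromaticNumber_le h
    rw [heq, Nat.cast_le] at h1
    omega
  · have := connected.nonempty
    rcases h with h | h | h
    · exact h.not_dpColorable loopless
    · exact h.not_dpColorable loopless
    · exact h.not_dpColorable loopless
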